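/- Let $K\subset\mathbb C$ be an imaginary quadratic number field with ring of integers $\mathcal O_K$ and discriminant $D_K$. Let $h(z)=-\mathrm{Re}(z_0\overline{z_2})+|z_1|^2$ on $\mathbb C^3$, let $U(1,2)$ be its unitary group and $PU(1,2)=U(1,2)/U(1)$ (viewed in $PGL_3(\mathbb C)$), let $PO(1,2)\subset PU(1,2)$ be the image of the group $O(1,2)$ of real matrices in $U(1,2)$, and let $\Gamma_K=PU(1,2)\cap PGL_3(\mathcal O_K)$ be the Picard modular group. For a positive integer $\Delta$ let $\Gamma_{K,\Delta}$ be the stabiliser in $\Gamma_K$ of the class of $$Y_\Delta=\begin{pmatrix}0&0&1/\Delta\\0&1&0\\\Delta&0&0\end{pmatrix}$$ for the action $[X]\cdot[Y]=[XY\overline X^{\,-1}]$. An $\mathbb R$-Fuchsian subgroup is a discrete subgroup of $PU(1,2)$ contained in a conjugate of $PO(1,2)$ in $PU(1,2)$; it is nonelementary if it has no finite orbit in $\{[z]\in\mathbb P_2(\mathbb C): h(z)\le 0\}$. For nonzero integers $a,b$ let $\mathcal Q=\left(\frac{a,b}{\mathbb Q}\right)$ be the quaternion algebra with $i^2=a$,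 $j^2=b$, $ij=-ji=k$, let $\mathcal Q(\mathbb R)^1$ be the group of elements of reduced norm $1$ of $\mathcal Q(\mathbb R)=\mathcal Q\otimes_{\mathbb Q}\mathbb R$, and let $\mathcal Q(\mathbb Z)^1$ be its subgroup of elements in $\mathbb Z+\mathbb Zi+\mathbb Zj+\mathbb Zk$. A nonelementary $\mathbb R$-Fuchsian subgroup $\Gamma$ arises from $\mathcal Q$ if $\mathcal Q(\mathbb R)\cong M_2(\mathbb R)$ and there is a Lie group epimorphism $\varphi$, with kernel the center of $\mathcal Q(\mathbb R)^1$, from $\mathcal Q(\mathbb R)^1$ onto the identity component of a conjugate of $PO(1,2)$ in $PU(1,2)$ containing $\Gamma$, such that $\Gamma$ and $\varphi(\mathcal Q(\mathbb Z)^1)$ are commensurable. Then, for every positive integer $\Delta$, the group $\Gamma_{K,\Delta}$ is a maximal nonelementary $\mathbb R$-Fuchsian subgroup of $\Gamma_K$, and it arises from the quaternion algebra $\left(\frac{\Delta,\,|D_K|}{\mathbb Q}\right)$. -/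

import Mathlib

open Matrix
open scoped Topology MatrixGroups Quaternion ComplexConjugate LinearAlgebra.Projectivization

namespace PicardRFuchsian

noncomputable section

/-! ### The groups `U(1,2)`, `PU(1,2)`, `O(1,2)`, `PO(1,2)` -/

/-- The matrix `I_{1,2}` of the Hermitian form `h`, over any field. -/
def formMatrix (F : Type*) [Field F] : Matrix (Fin 3) (Fin 3) F :=
  !![0, 0, -1/2; 0, 1, 0; -1/2, 0, 0]

/-- The Hermitian form `h(z) = z^* I_{1,2} z = -Re(z₀ conj z₂) + |z₁|²`. -/
def hermForm (z : Fin 3 → ℂ) : ℝ := (star z ⬝ᵥ (formMatrix ℂ *ᵥ z)).re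

/-- `U(1,2)`: the invertible complex matrices preserving `h`. -/
def U12 : Subgroup (GL (Fin 3) ℂ) where
  carrier := {X | (X : Matrix (Fin 3) (Fin 3) ℂ)ᴴ * formMatrix ℂ * X = formMatrix ℂ}
  one_mem' := by simp
  mul_mem' := by
    intro X Y hX hY
    simp only [Set.mem_ofPred_eq] at hX hY ⊢
    calc _ = (Y : Matrix (Fin 3) (Fin 3) ℂ)ᴴ *
          ((X : Matrix (Fin 3) (Fin 3) ℂ)ᴴ * formMatrix ℂ * X) * Y := by
          simp only [GeneralLinearGroup.coe_mul, conjTranspose_mul, Matrix.mul_assoc]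
      _ = _ := by rw [hX, hY]
  inv_mem' := by
    intro X hX
    simp only [Set.mem_ofPred_eq] at hX ⊢
    have h1 : (X : Matrix (Fin 3) (Fin 3) ℂ) * ((X⁻¹ : GL (Fin 3) ℂ) : Matrix _ _ ℂ) = 1 :=
      X.mul_inv
    have h2 : ((X⁻¹ : GL (Fin 3) ℂ) : Matrix (Fin 3) (Fin 3) ℂ)ᴴ *
        (X : Matrix (Fin 3) (Fin 3) ℂ)ᴴ = 1 := by
      rw [← conjTranspose_mul, h1, conjTranspose_one]
    calc _ = ((X⁻¹ : GL (Fin 3) ℂ) : Matrix (Fin 3) (Fin 3) ℂ)ᴴ *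
          ((X : Matrix (Fin 3) (Fin 3) ℂ)ᴴ * formMatrix ℂ * X) *
          ((X⁻¹ : GL (Fin 3) ℂ) : Matrix (Fin 3) (Fin 3) ℂ) := by rw [hX]
      _ = (((X⁻¹ : GL (Fin 3) ℂ) : Matrix (Fin 3) (Fin 3) ℂ)ᴴ *
          (X : Matrix (Fin 3) (Fin 3) ℂ)ᴴ) * formMatrix ℂ *
          ((X : Matrix (Fin 3) (Fin 3) ℂ) *
          ((X⁻¹ : GL (Fin 3) ℂ) : Matrix (Fin 3) (Fin 3) ℂ)) := by
          simp only [Matrix.mul_assoc]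
      _ = _ := by rw [h1, h2, Matrix.one_mul, Matrix.mul_one]

/-- `O(1,2)`: the real invertible matrices `X` preserving the restriction of `h` to `ℝ³`; a real
matrix does so if and only if it lies in `U(1,2)`. -/
def O12 : Subgroup (GL (Fin 3) ℝ) :=
  U12.comap (GeneralLinearGroup.map Complex.ofRealHom)

/-- The quotient topology on `PGL₃(ℂ)`. -/
instance instTopologicalSpacePGL : TopologicalSpace PGL(3, ℂ) :=
  TopologicalSpace.coinduced (ProjGenLinGroup.mk : GL (Fin 3) ℂ → PGL(3, ℂ)) inferInstance

/-- `PU(1,2) = U(1,2) / U(1)`, realised as the image of `U(1,2)` in `PGL₃(ℂ)`. -/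
def PU12 : Subgroup PGL(3, ℂ) := U12.map ProjGenLinGroup.mk

/-- `PO(1,2)`, the image of `O(1,2)` in `PU(1,2)`. It has two connected components. -/
def PO12 : Subgroup PGL(3, ℂ) :=
  O12.map (ProjGenLinGroup.mk.comp (GeneralLinearGroup.map Complex.ofRealHom))

/-- The conjugate `c PO(1,2) c⁻¹`; for `c ∈ PU(1,2)` this is the stabiliser in `PU(1,2)` of
the totally real plane `c · ℙ(ℝ³)`. -/
def conjPO12 (c : PGL(3, ℂ)) : Subgroup PGL(3, ℂ) :=
  PO12.map (MulAut.conj c).toMonoidHom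

/-! ### `ℝ`-Fuchsian subgroups -/

/-- An `ℝ`-Fuchsian subgroup: a discrete subgroup of `PU(1,2)` preserving a maximal totally real
subspace, that is, contained in a conjugate of `PO(1,2)` in `PU(1,2)`. -/
def IsRFuchsian (Γ : Subgroup PGL(3, ℂ)) : Prop :=
  DiscreteTopology Γ ∧ ∃ c ∈ PU12, Γ ≤ conjPO12 c

/-- Nonelementary: no finite orbit in the closure `{[z] : h(z) ≤ 0}` of the complex hyperbolic
plane. For discrete subgroups of `PU(1,2)` this is equivalent to the limit set having more than
two points. -/
def IsNonelementary (Γ : Subgroup PGL(3, ℂ)) : Prop :=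
  ∀ (z : Fin 3 → ℂ) (hz : z ≠ 0), hermForm z ≤ 0 →
    (MulAction.orbit Γ (Projectivization.mk ℂ z hz : ℙ ℂ (Fin 3 → ℂ))).Infinite

/-- `Γ` is a maximal nonelementary `ℝ`-Fuchsian subgroup of `G`: it is maximal for inclusion
among the subgroups of `G` that are nonelementary and `ℝ`-Fuchsian. -/
def IsMaximalNonelementaryRFuchsian (G Γ : Subgroup PGL(3, ℂ)) : Prop :=
  Maximal (fun H : Subgroup PGL(3, ℂ) => H ≤ G ∧ IsRFuchsian H ∧ IsNonelementary H) Γ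

/-! ### The Picard modular group and the stabilisers `Γ_{K,Δ}` -/

/-- The Picard modular group `Γ_K = PU(1,2) ∩ PGL₃(𝓞_K)`, where `K` is viewed in `ℂ` through the
embedding `ι`. -/
def picard {K : Type*} [Field K] (ι : K →+* ℂ) : Subgroup PGL(3, ℂ) :=
  PU12 ⊓ (ProjGenLinGroup.map (n := Fin 3)
    (ι.comp (algebraMap (NumberField.RingOfIntegers K) K))).range

/-- The unitary-symmetric matrix `Y_Δ`, for `Δ` a nonzero complex number. -/
def Y (Δ : ℂ) (hΔ : Δ ≠ 0) : GL (Fin 3) ℂ :=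
  GeneralLinearGroup.mkOfDetNeZero !![0, 0, 1 / conj Δ; 0, 1, 0; Δ, 0, 0] (by
    simp [det_fin_three, hΔ])

/-- `Γ_{K,Δ}`, the stabiliser of `[Y_Δ]` in `Γ_K` for the action
`[X] · [Y] = [X Y (conj X)⁻¹]`. -/
def stabY {K : Type*} [Field K] (ι : K →+* ℂ) (Δ : ℂ) (hΔ : Δ ≠ 0) : Subgroup PGL(3, ℂ) where
  carrier := {g | g ∈ picard ι ∧
    g * ProjGenLinGroup.mk (Y Δ hΔ) * (ProjGenLinGroup.map (starRingEnd ℂ) g)⁻¹ =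
      ProjGenLinGroup.mk (Y Δ hΔ)}
  one_mem' := ⟨one_mem _, by simp⟩
  mul_mem' := by
    rintro g g' ⟨hg, h⟩ ⟨hg', h'⟩
    refine ⟨mul_mem hg hg', ?_⟩
    rw [mul_inv_eq_iff_eq_mul] at h h' ⊢
    rw [mul_assoc, h', ← mul_assoc, h, map_mul, mul_assoc]
  inv_mem' := by
    rintro g ⟨hg, h⟩
    refine ⟨inv_mem hg, ?_⟩
    rw [mul_inv_eq_iff_eq_mul] at h ⊢
    rw [inv_mul_eq_iff_eq_mul, ← mul_assoc, h, map_inv, mul_inv_cancel_right]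

/-! ### Quaternion algebras -/

/-- The `R`-points of the quaternion algebra `(a, b / ℚ)`: quaternions `x₀ + x₁ i + x₂ j + x₃ k`
with `x₀, x₁, x₂, x₃ ∈ R`, where `i² = a`, `j² = b`, `ij = -ji = k`. For `R = ℚ` this is the
quaternion algebra itself, for `R = ℝ` its extension of scalars to `ℝ`, and for `R = ℤ` the order
`ℤ + ℤ i + ℤ j + ℤ k`. -/
abbrev QuatPoints (R : Type*) [CommRing R] (a b : ℤ) : Type _ := ℍ[R, (a : R), (b : R)]

/-- The group `𝒬(ℝ)¹` of real quaternions `x` with reduced norm `x (conj x) = 1`. -/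
abbrev NormOne (a b : ℤ) : Type := unitary (QuatPoints ℝ a b)

/-- The topology on `𝒬(ℝ)¹` as a subset of `𝒬(ℝ) = ℝ⁴`. -/
abbrev normOneTopology (a b : ℤ) : TopologicalSpace (NormOne a b) :=
  TopologicalSpace.induced
    (fun x => QuaternionAlgebra.equivTuple _ _ _ (x : QuatPoints ℝ a b)) inferInstance

/-- The quaternion in `𝒬(ℝ)` with the same coordinates as `q ∈ 𝒬(ℤ)`. -/
def ofInt {a b : ℤ} (q : QuatPoints ℤ a b) : QuatPoints ℝ a b :=
  ⟨q.re, q.imI, q.imJ, q.imK⟩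

/-- The subgroup `𝒬(ℤ)¹` of `𝒬(ℝ)¹` of elements with integral coordinates. -/
def integralNormOne (a b : ℤ) : Subgroup (NormOne a b) where
  carrier := {x | ∃ q : QuatPoints ℤ a b, ofInt q = (x : QuatPoints ℝ a b)}
  one_mem' := ⟨1, by ext <;> simp [ofInt]⟩
  mul_mem' := by
    rintro x y ⟨p, hp⟩ ⟨q, hq⟩
    refine ⟨p * q, ?_⟩
    rw [Submonoid.coe_mul, ← hp, ← hq]
    ext <;> simp [ofInt]
  inv_mem' := by
    rintro x ⟨p, hp⟩
    refine ⟨star p, ?_⟩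
    rw [← Unitary.star_eq_inv, Unitary.coe_star, ← hp]
    ext <;> simp [ofInt]

/-- The nonelementary `ℝ`-Fuchsian subgroup `Γ` of `PU(1,2)` arises from the quaternion algebra
`𝒬 = (a, b / ℚ)`: the algebra splits over `ℝ`, and there is a Lie group epimorphism `φ`
(a continuous, hence smooth, homomorphism) with kernel the center of `𝒬(ℝ)¹`, from `𝒬(ℝ)¹` onto
the identity component of a conjugate of `PO(1,2)` containing `Γ`, such that `Γ` and `φ(𝒬(ℤ)¹)`
are commensurable. -/
def ArisesFrom (Γ : Subgroup PGL(3, ℂ)) (a b : ℤ) : Prop :=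
  IsRFuchsian Γ ∧ IsNonelementary Γ ∧
  Nonempty (QuatPoints ℝ a b ≃ₐ[ℝ] Matrix (Fin 2) (Fin 2) ℝ) ∧
  ∃ c ∈ PU12, Γ ≤ conjPO12 c ∧
    ∃ φ : NormOne a b →* PGL(3, ℂ),
      Continuous[normOneTopology a b, instTopologicalSpacePGL] φ ∧
      (φ.range : Set PGL(3, ℂ)) = connectedComponentIn (conjPO12 c : Set PGL(3, ℂ)) 1 ∧
      φ.ker = Subgroup.center (NormOne a b) ∧
      Subgroup.Commensurable Γ ((integralNormOne a b).map φ)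

end

end PicardRFuchsian

/-! Write a = Δ and b = |D_K|. The antilinear map z ↦ Y_Δ z̄ is an involution, the real structure
whose real points are the image of ℝ³ under the unitary matrix `frame`. Its stabiliser in PU(1,2) is
therefore a conjugate of PO(1,2), and Γ_{K,Δ} is the intersection of that conjugate with PGL₃(𝓞_K)
(`stabY_eq`).

The pure quaternions of (a, b), with the form diag(a, b, -ab), are similar to ℝ³ with h. Hence
conjugation x ↦ q x q⁻¹ maps the real units onto the conjugate of PO(1,2) (`range_projAd`) and the
norm one group onto its identity component (`range_normOneHom`). The change of basis `pureFrame` has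
entries in ℤ[√-b], and 𝓞_K contains √-b (`exists_sq_eq_neg_abs_discr`). The two integral structures
thus differ by bounded denominators: a congruence subgroup of 𝒬(ℤ)¹ lands in Γ_{K,Δ}
(`projAd_mem_range_map`), while every element of Γ_{K,Δ} comes from an integral quaternion whose
norm divides a fixed integer (`exists_int_quaternion`). Commensurability follows by counting
residues.

Pell's equation gives elements x + y t of the congruence subgroup for suitable pure t. Two
directions t suffice to act irreducibly on ℂ³ (`exists_irreduciblePair`). Having no common
eigenvector makes the group nonelementary. Having only scalar commutant makes the real structure
preserved by the group unique, which is maximality (`le_stabY_of_le`). Discreteness holds because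
adjoint coordinates lie in the discrete ring 𝓞_K. -/

namespace PicardRFuchsian

/-! ### Integers of an imaginary quadratic field -/

section ImaginaryQuadratic

open NumberField

variable {K : Type*} [Field K]

theorem embedding_ne_conj [IsTotallyComplex K] (ι : K →+* ℂ) : (starRingEnd ℂ).comp ι ≠ ι := by
  intro h
  have h1 : InfinitePlace.IsReal (InfinitePlace.mk ι) :=
    InfinitePlace.isReal_mk_iff.mpr h
  exact InfinitePlace.not_isReal_iff_isComplex.mpr
    (IsTotallyComplex.isComplex (InfinitePlace.mk ι)) h1

variable [NumberField K] [IsTotallyComplex K]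

/-- In an imaginary quadratic field the trace is the sum of an element and its conjugate. -/
theorem trace_eq_add_conj (hK : Module.finrank ℚ K = 2) (ι : K →+* ℂ) (x : 𝓞 K) :
    ((Algebra.trace ℤ (𝓞 K) x : ℤ) : ℂ) = ι x + conj (ι x) := by
  classical
  have h1 : ((Algebra.trace ℤ (𝓞 K) x : ℤ) : ℂ)
      = algebraMap ℚ ℂ (Algebra.trace ℚ K (x : K)) := by
    rw [← Algebra.coe_trace_int]; simp
  rw [h1, trace_eq_sum_embeddings (E := ℂ)]
  let f : K →ₐ[ℚ] ℂ := ι.toRatAlgHom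
  let g : K →ₐ[ℚ] ℂ := ((starRingEnd ℂ).comp ι).toRatAlgHom
  have hfg : f ≠ g := by
    intro h
    apply embedding_ne_conj ι
    ext y
    exact (DFunLike.congr_fun h y).symm
  have hu : (Finset.univ : Finset (K →ₐ[ℚ] ℂ)) = {f, g} := by
    symm
    apply Finset.eq_univ_of_card
    rw [Finset.card_pair hfg, AlgHom.card, hK]
  rw [hu, Finset.sum_pair hfg]
  rfl

/-- For an integral basis, d is up to sign the determinant of the matrix of the two embeddings, so
d² is the discriminant. It is purely imaginary, which forces the sign. -/
theorem exists_sq_eq_neg_abs_discr (hK : Module.finrank ℚ K = 2) (ι : K →+* ℂ) :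
    ∃ d : 𝓞 K, ι d ^ 2 = -((|discr K| : ℤ) : ℂ) := by
  classical
  have hcard : Module.finrank ℤ (𝓞 K) = 2 := by rw [RingOfIntegers.rank, hK]
  let B := (Module.finBasisOfFinrankEq ℤ (𝓞 K) hcard)
  let T : 𝓞 K → ℤ := Algebra.trace ℤ (𝓞 K)
  let d : 𝓞 K := (T (B 1) : 𝓞 K) * B 0 - (T (B 0) : 𝓞 K) * B 1
  have hT : ∀ x : 𝓞 K, ((T x : ℤ) : ℂ) = ι x + conj (ι x) := trace_eq_add_conj hK ι
  have hd : ι d = ι (B 0) * conj (ι (B 1)) - conj (ι (B 0)) * ι (B 1) := by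
    simp only [d, map_sub, map_mul, map_intCast, hT]
    ring
  have hdc : conj (ι d) = -ι d := by
    rw [hd]; simp only [map_sub, map_mul, Complex.conj_conj]; ring
  have hdisc : ((discr K : ℤ) : ℂ) = ι d ^ 2 := by
    rw [← discr_eq_discr K B, Algebra.discr_def, det_fin_two]
    simp only [Algebra.traceMatrix_apply, Algebra.traceForm_apply]
    push_cast
    change (T _ : ℂ) * (T _ : ℂ) - (T _ : ℂ) * (T _ : ℂ) = _
    rw [hT, hT, hT, hT, hd]
    simp only [map_mul]
    ring
  have hneg : discr K < 0 := by
    have h0 := discr_ne_zero K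
    have hre : (ι d).re = 0 := by
      have := congrArg Complex.re hdc
      simp at this; linarith
    have h2 := congrArg Complex.re hdisc
    simp only [sq, Complex.mul_re, hre, Complex.intCast_re] at h2
    have h3 : ((discr K : ℤ) : ℝ) ≤ 0 := by rw [h2]; nlinarith [sq_nonneg (ι d).im]
    have h4 : discr K ≤ 0 := by exact_mod_cast h3
    omega
  exact ⟨d, by rw [← hdisc, abs_of_neg hneg]; push_cast; ring⟩

theorem two_mul_re_int (hK : Module.finrank ℚ K = 2) (ι : K →+* ℂ) {x : ℝ} {w : 𝓞 K}
    (h : (x : ℂ) = ι w) : ∃ m : ℤ, 2 * x = m := by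
  refine ⟨Algebra.trace ℤ (𝓞 K) w, ?_⟩
  have h1 := trace_eq_add_conj hK ι w
  rw [← h, Complex.conj_ofReal] at h1
  apply_fun ((↑) : ℝ → ℂ) using Complex.ofReal_injective
  push_cast
  rw [h1]; ring

/-- Nonzero algebraic integers of an imaginary quadratic field have absolute value at least `1`. -/
theorem one_le_norm_of_ne_zero (hK : Module.finrank ℚ K = 2) (ι : K →+* ℂ) {w : 𝓞 K}
    (hw : w ≠ 0) : 1 ≤ ‖ι w‖ := by
  -- The second factor is the conjugate of w, so v is |w|². It is half of an integer by
  -- `two_mul_re_int`, and being integral it is then a positive integer.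
  let v : 𝓞 K := w * ((Algebra.trace ℤ (𝓞 K) w : ℤ) - w)
  have hv : ι v = ((‖ι w‖ ^ 2 : ℝ) : ℂ) := by
    have h1 := trace_eq_add_conj hK ι w
    simp only [v, map_mul, map_sub, map_intCast, h1]
    rw [add_sub_cancel_left, Complex.mul_conj']
    push_cast; rfl
  obtain ⟨m, hm⟩ := two_mul_re_int hK ι hv.symm
  have h2 : IsIntegral ℤ (v : K) := v.2
  have hvq : (v : K) = algebraMap ℚ K ((m : ℚ) / 2) := by
    apply ι.injective
    rw [hv]
    have : (‖ι w‖ ^ 2 : ℝ) = m / 2 := by linarith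
    rw [this]; simp only [map_div₀, map_intCast, map_ofNat]; push_cast; rfl
  rw [hvq] at h2
  have h3 := (isIntegral_algebraMap_iff (algebraMap ℚ K).injective).mp h2
  obtain ⟨n, hn⟩ := IsIntegrallyClosed.isIntegral_iff.mp h3
  have h4 : (‖ι w‖ ^ 2 : ℝ) = n := by
    have h5 : (n : ℚ) = m / 2 := by simpa using hn
    have h6 : (n : ℝ) = m / 2 := by exact_mod_cast congrArg ((↑) : ℚ → ℝ) h5
    linarith
  have hpos : 0 < ‖ι w‖ := by
    rw [norm_pos_iff]
    simpa using hw
  have h7 : (0 : ℝ) < n := by rw [← h4]; positivity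
  have h8 : (1 : ℝ) ≤ n := by exact_mod_cast (by exact_mod_cast h7 : (0 : ℤ) < n)
  nlinarith

end ImaginaryQuadratic

/-! ### Adjoint coordinates and discreteness in PGL₃(ℂ) -/

section ProjectiveGroup

/-- The coordinates `X_{ij} (X⁻¹)_{kl}` of the adjoint representation of `PGL₃(ℂ)`. -/
noncomputable def adjCoord (g : PGL(3, ℂ)) (p : (Fin 3 × Fin 3) × (Fin 3 × Fin 3)) : ℂ :=
  Quotient.liftOn' g
    (fun X : GL (Fin 3) ℂ => X.1 p.1.1 p.1.2 * (X⁻¹).1 p.2.1 p.2.2) (by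
      intro X X' h
      have h' : ProjGenLinGroup.mk X = ProjGenLinGroup.mk X' := Quotient.sound' h
      obtain ⟨u, rfl⟩ := ProjGenLinGroup.mk_eq_mk_iff.mp h'
      have h2 : (X * GeneralLinearGroup.scalar (Fin 3) u)⁻¹
        = GeneralLinearGroup.scalar (Fin 3) u⁻¹ * X⁻¹ := by
        rw [_root_.mul_inv_rev, map_inv]
      simp only [h2, Units.val_mul, GeneralLinearGroup.coe_scalar]
      rw [scalar_apply, scalar_apply, mul_diagonal, diagonal_mul]
      have := u.ne_zero
      simp only [Units.val_inv_eq_inv_val]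
      field_simp)

@[simp]
theorem adjCoord_mk (X : GL (Fin 3) ℂ) (p : (Fin 3 × Fin 3) × (Fin 3 × Fin 3)) :
    adjCoord (ProjGenLinGroup.mk X) p = X.1 p.1.1 p.1.2 * (X⁻¹).1 p.2.1 p.2.2 := rfl

theorem continuous_mk : Continuous (ProjGenLinGroup.mk : GL (Fin 3) ℂ → PGL(3, ℂ)) :=
  continuous_coinduced_rng

theorem continuous_of_comp_mk {α : Type*} [TopologicalSpace α] {f : PGL(3, ℂ) → α}
    (hf : Continuous fun X : GL (Fin 3) ℂ => f (ProjGenLinGroup.mk X)) : Continuous f :=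
  continuous_coinduced_dom.mpr hf

theorem continuous_coe_apply (i j : Fin 3) : Continuous fun X : GL (Fin 3) ℂ => X.1 i j :=
  Units.continuous_val.matrix_elem i j

theorem continuous_coe_inv_apply (i j : Fin 3) :
    Continuous fun X : GL (Fin 3) ℂ => (X⁻¹).1 i j :=
  Units.continuous_coe_inv.matrix_elem i j

theorem continuous_adjCoord : Continuous adjCoord := by
  apply continuous_of_comp_mk
  refine continuous_pi fun p => ?_
  simp only [adjCoord_mk]
  exact (continuous_coe_apply _ _).mul (continuous_coe_inv_apply _ _)

theorem mk_eq_mk_of_smul {n F : Type*} [Fintype n] [DecidableEq n] [Field F] {X X' : GL n F}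
    {c : F} (hc : c ≠ 0) (h : (X' : Matrix n n F) = c • (X : Matrix n n F)) :
    ProjGenLinGroup.mk X = ProjGenLinGroup.mk X' := by
  rw [ProjGenLinGroup.mk_eq_mk_iff]
  refine ⟨Units.mk0 c hc, Units.ext ?_⟩
  simp [h, ← smul_eq_mul_diagonal]

theorem exists_smul_of_mk_eq_mk {n F : Type*} [Fintype n] [DecidableEq n] [Field F] {X X' : GL n F}
    (h : ProjGenLinGroup.mk X = ProjGenLinGroup.mk X') :
    ∃ c : F, c ≠ 0 ∧ (X' : Matrix n n F) = c • (X : Matrix n n F) := by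
  obtain ⟨u, rfl⟩ := ProjGenLinGroup.mk_eq_mk_iff.mp h
  exact ⟨u, u.ne_zero, by simp [← smul_eq_mul_diagonal]⟩

/-- A nonzero entry of X⁻¹ singles out nine coordinates, which are the entries of X up to a common
nonzero factor. -/
theorem adjCoord_injective : Function.Injective adjCoord := by
  intro g g' h
  obtain ⟨X, rfl⟩ := ProjGenLinGroup.mk_surjective g
  obtain ⟨X', rfl⟩ := ProjGenLinGroup.mk_surjective g'
  obtain ⟨k, l, hkl⟩ : ∃ k l, (X⁻¹).1 k l ≠ 0 := by
    by_contra! h0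
    have : (X⁻¹).1 = 0 := by ext k l; exact h0 k l
    exact (X⁻¹).ne_zero this
  have h1 : ∀ i j, X.1 i j * (X⁻¹).1 k l = X'.1 i j * (X'⁻¹).1 k l := fun i j =>
    congrFun h ((i, j), (k, l))
  have h2 : (X'⁻¹).1 k l ≠ 0 := by
    intro h0
    apply X.ne_zero
    ext i j
    have := h1 i j
    rw [h0, mul_zero] at this
    exact (mul_eq_zero.mp this).resolve_right hkl
  apply mk_eq_mk_of_smul (c := (X⁻¹).1 k l / (X'⁻¹).1 k l) (div_ne_zero hkl h2)
  ext i j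
  rw [Matrix.smul_apply, smul_eq_mul]
  field_simp
  rw [← h1 i j]; ring

theorem adjCoord_map_mem_range {R : Type*} [CommRing R] (f : R →+* ℂ) {g : PGL(3, ℂ)}
    (hg : g ∈ (ProjGenLinGroup.map (n := Fin 3) f).range) (p) : adjCoord g p ∈ f.range := by
  obtain ⟨g, rfl⟩ := hg
  obtain ⟨X, rfl⟩ := ProjGenLinGroup.mk_surjective g
  rw [ProjGenLinGroup.map_mk, adjCoord_mk, ← map_inv]
  exact ⟨X.1 p.1.1 p.1.2 * (X⁻¹).1 p.2.1 p.2.2, by rw [map_mul]; rfl⟩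

/-- The adjoint coordinates inject Γ continuously into a finite power of the discrete ring f(R). -/
theorem discreteTopology_of_le_range {R : Type*} [CommRing R] (f : R →+* ℂ)
    (hf : ∀ x, f x ≠ 0 → 1 ≤ ‖f x‖) {Γ : Subgroup PGL(3, ℂ)}
    (hΓ : Γ ≤ (ProjGenLinGroup.map (n := Fin 3) f).range) : DiscreteTopology Γ := by
  have hd : DiscreteTopology f.range := by
    refine DiscreteTopology.of_forall_le_dist one_pos ?_
    rintro ⟨_, x, rfl⟩ ⟨_, y, rfl⟩ hxy
    rw [Subtype.dist_eq, dist_eq_norm, ← map_sub]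
    apply hf
    rw [map_sub, sub_ne_zero]
    intro h; exact hxy (Subtype.ext h)
  let F : Γ → ((Fin 3 × Fin 3) × (Fin 3 × Fin 3)) → f.range := fun g p =>
    ⟨adjCoord g.1 p, adjCoord_map_mem_range f (hΓ g.2) p⟩
  have hF : Continuous F := by
    refine continuous_pi fun p => Continuous.subtype_mk ?_ _
    exact (continuous_apply p).comp (continuous_adjCoord.comp continuous_subtype_val)
  refine DiscreteTopology.of_continuous_injective hF ?_
  intro g g' h
  apply Subtype.ext
  apply adjCoord_injective
  funext p
  exact congrArg Subtype.val (congrFun h p)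

end ProjectiveGroup

/-! ### Reduced norm and adjoint matrices over a commutative ring -/

section Quaternions

variable {R : Type*} [CommRing R] {a b : R}

/-- The reduced norm of a quaternion. -/
def nrd (q : ℍ[R, a, b]) : R :=
  q.re ^ 2 - a * q.imI ^ 2 - b * q.imJ ^ 2 + a * b * q.imK ^ 2

theorem mul_star_eq_nrd (q : ℍ[R, a, b]) : q * star q = ((nrd q : R) : ℍ[R, a, b]) := by
  ext
  · rw [QuaternionAlgebra.re_coe]; simp [nrd]; ring
  all_goals simp; try ring

theorem star_mul_eq_nrd (q : ℍ[R, a, b]) : star q * q = ((nrd q : R) : ℍ[R, a, b]) := by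
  ext
  · rw [QuaternionAlgebra.re_coe]; simp [nrd]; ring
  all_goals simp; try ring

theorem nrd_mul (p q : ℍ[R, a, b]) : nrd (p * q) = nrd p * nrd q := by
  simp [nrd]; ring

@[simp]
theorem nrd_one : nrd (1 : ℍ[R, a, b]) = 1 := by simp [nrd]

@[simp]
theorem nrd_star (q : ℍ[R, a, b]) : nrd (star q) = nrd q := by simp [nrd]

theorem nrd_smul (c : R) (q : ℍ[R, a, b]) : nrd (c • q) = c ^ 2 * nrd q := by
  simp [nrd]; ring

/-- The matrix, in the basis `i, j, k`, of the map `x ↦ q x (conj q)` on pure quaternions. -/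
def adM (q : ℍ[R, a, b]) : Matrix (Fin 3) (Fin 3) R :=
  !![q.re ^ 2 - a * q.imI ^ 2 + b * q.imJ ^ 2 - a * b * q.imK ^ 2,
      -2 * b * q.imI * q.imJ + 2 * b * q.re * q.imK,
      2 * a * b * q.imI * q.imK - 2 * b * q.re * q.imJ;
    -2 * a * q.imI * q.imJ - 2 * a * q.re * q.imK,
      q.re ^ 2 + a * q.imI ^ 2 - b * q.imJ ^ 2 - a * b * q.imK ^ 2,
      2 * a * b * q.imJ * q.imK + 2 * a * q.re * q.imI;
    -2 * a * q.imI * q.imK - 2 * q.re * q.imJ,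
      -2 * b * q.imJ * q.imK + 2 * q.re * q.imI,
      q.re ^ 2 + a * q.imI ^ 2 + b * q.imJ ^ 2 + a * b * q.imK ^ 2]

theorem mul_pure_mul_star (q : ℍ[R, a, b]) (v : Fin 3 → R) :
    q * (⟨0, v 0, v 1, v 2⟩ : ℍ[R, a, b]) * star q =
      ⟨0, (adM q *ᵥ v) 0, (adM q *ᵥ v) 1, (adM q *ᵥ v) 2⟩ := by
  ext <;> simp [adM, Matrix.mulVec, dotProduct, Fin.sum_univ_three] <;> ring

@[simp]
theorem adM_one : adM (1 : ℍ[R, a, b]) = 1 := by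
  ext i j; fin_cases i <;> fin_cases j <;> simp [adM]

theorem adM_mul (p q : ℍ[R, a, b]) : adM (p * q) = adM p * adM q := by
  ext i j
  fin_cases i <;> fin_cases j <;> simp [adM, Matrix.mul_apply, Fin.sum_univ_three] <;> ring

theorem adM_smul (c : R) (q : ℍ[R, a, b]) : adM (c • q) = c ^ 2 • adM q := by
  ext i j; fin_cases i <;> fin_cases j <;> simp [adM] <;> ring

theorem adM_coe (c : R) : adM (c : ℍ[R, a, b]) = c ^ 2 • (1 : Matrix (Fin 3) (Fin 3) R) := by
  ext i j; fin_cases i <;> fin_cases j <;> simp [adM]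

theorem adM_mul_adM_star (q : ℍ[R, a, b]) :
    adM q * adM (star q) = nrd q ^ 2 • (1 : Matrix (Fin 3) (Fin 3) R) := by
  rw [← adM_mul, mul_star_eq_nrd, adM_coe]

theorem det_adM (q : ℍ[R, a, b]) : (adM q).det = nrd q ^ 3 := by
  rw [det_fin_three]; simp [adM, nrd]; ring

/-- The matrix of the reduced norm on pure quaternions, up to sign. -/
def pureForm (a b : R) : Matrix (Fin 3) (Fin 3) R := diagonal ![a, b, -(a * b)]

theorem adM_isometry (q : ℍ[R, a, b]) :
    (adM q)ᵀ * pureForm a b * adM q = nrd q ^ 2 • pureForm a b := by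
  ext i j
  fin_cases i <;> fin_cases j <;>
    simp [adM, pureForm, nrd, Matrix.mul_apply, Fin.sum_univ_three, diagonal] <;> ring

/-- Half of the matrix of the commutator `x ↦ t x - x t` on pure quaternions, for the pure
quaternion `t = x i + y j + z k`. -/
def adL (a b x y z : R) : Matrix (Fin 3) (Fin 3) R :=
  !![0, b * z, -(b * y); -(a * z), 0, a * x; -y, x, 0]

/-- When q has norm one, star q is its inverse. Subtracting the inverse recovers the Lie algebra
direction of q, so irreducibility can be tested on the matrices `adL`, which are linear in the pure
part. -/
theorem adM_sub_adM_star (q : ℍ[R, a, b]) :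
    adM q - adM (star q) = (4 * q.re) • adL a b q.imI q.imJ q.imK := by
  ext i j; fin_cases i <;> fin_cases j <;> simp [adM, adL] <;> ring

end Quaternions

/-! ### Split real quaternion algebras and their isometries -/

section RealQuaternions

variable {a b : ℝ}

theorem isUnit_of_nrd_ne_zero {q : ℍ[ℝ, a, b]} (h : nrd q ≠ 0) : IsUnit q := by
  refine ⟨⟨q, (nrd q)⁻¹ • star q, ?_, ?_⟩, rfl⟩
  · rw [mul_smul_comm, mul_star_eq_nrd]; ext <;> simp [h]
  · rw [smul_mul_assoc, star_mul_eq_nrd]; ext <;> simp [h]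

theorem nrd_ne_zero (u : ℍ[ℝ, a, b]ˣ) : nrd (u : ℍ[ℝ, a, b]) ≠ 0 := by
  intro h
  have h1 : nrd ((u : ℍ[ℝ, a, b]) * ((u⁻¹ : ℍ[ℝ, a, b]ˣ) : ℍ[ℝ, a, b])) = 1 := by rw [Units.mul_inv, nrd_one]
  rw [nrd_mul, h, zero_mul] at h1
  exact zero_ne_one h1

theorem coe_inv_eq (u : ℍ[ℝ, a, b]ˣ) :
    ((u⁻¹ : ℍ[ℝ, a, b]ˣ) : ℍ[ℝ, a, b]) = (nrd (u : ℍ[ℝ, a, b]))⁻¹ • star (u : ℍ[ℝ, a, b]) := by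
  rw [Units.inv_eq_of_mul_eq_one_right]
  rw [mul_smul_comm, mul_star_eq_nrd]; ext <;> simp [nrd_ne_zero u]

/-- A quaternion algebra `(a, b)` with `a > 0` splits over `ℝ`. -/
noncomputable def splitHom (ha : 0 < a) (b : ℝ) : ℍ[ℝ, a, b] →ₐ[ℝ] Matrix (Fin 2) (Fin 2) ℝ :=
  QuaternionAlgebra.Basis.liftHom
    { i := !![√a, 0; 0, -√a]
      j := !![0, b; 1, 0]
      k := !![0, √a * b; -√a, 0]
      i_mul_i := by
        ext i j; fin_cases i <;> fin_cases j <;> simp [Matrix.mul_apply, ha.le]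
      j_mul_j := by
        ext i j; fin_cases i <;> fin_cases j <;> simp [Matrix.mul_apply]
      i_mul_j := by
        ext i j; fin_cases i <;> fin_cases j <;> simp [Matrix.mul_apply]
      j_mul_i := by
        ext i j; fin_cases i <;> fin_cases j <;> simp [Matrix.mul_apply]; ring }

theorem splitHom_apply (ha : 0 < a) (q : ℍ[ℝ, a, b]) :
    splitHom ha b q = !![q.re + q.imI * √a, b * (q.imJ + √a * q.imK);
      q.imJ - √a * q.imK, q.re - q.imI * √a] := by
  ext i j
  fin_cases i <;> fin_cases j <;>
    simp [splitHom, QuaternionAlgebra.Basis.lift, Matrix.algebraMap_matrix_apply] <;> ring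

theorem splitHom_injective (ha : 0 < a) (hb : 0 < b) : Function.Injective (splitHom ha b) := by
  rw [injective_iff_map_eq_zero]
  intro q hq
  rw [splitHom_apply] at hq
  have h00 := congrFun (congrFun hq 0) 0
  have h01 := congrFun (congrFun hq 0) 1
  have h10 := congrFun (congrFun hq 1) 0
  have h11 := congrFun (congrFun hq 1) 1
  simp [hb.ne'] at h00 h01 h10 h11
  have hs : 0 < √a := Real.sqrt_pos.mpr ha
  have e1 : q.re = 0 := by linarith
  have e2 : q.imI = 0 := by
    have : q.imI * √a = 0 := by linarith
    simpa [hs.ne'] using this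
  have e3 : q.imJ = 0 := by linarith
  have e4 : q.imK = 0 := by
    have : √a * q.imK = 0 := by linarith
    simpa [hs.ne'] using this
  ext <;> simp [e1, e2, e3, e4]

/-- The splitting of `(a, b)` over `ℝ`, for `a, b > 0`. -/
noncomputable def splitEquiv (ha : 0 < a) (hb : 0 < b) :
    ℍ[ℝ, a, b] ≃ₐ[ℝ] Matrix (Fin 2) (Fin 2) ℝ :=
  AlgEquiv.ofBijective (splitHom ha b) ⟨splitHom_injective ha hb, by
    refine (LinearMap.injective_iff_surjective_of_finrank_eq_finrank
      (f := (splitHom ha b).toLinearMap) ?_).mp (splitHom_injective ha hb)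
    rw [QuaternionAlgebra.finrank_eq_four, Module.finrank_matrix]; simp⟩

/-- Algebra endomorphisms of a real split quaternion algebra are inner. -/
theorem exists_unit_conj (ha : 0 < a) (hb : 0 < b) (f : ℍ[ℝ, a, b] →ₐ[ℝ] ℍ[ℝ, a, b])
    (hf : Function.Injective f) : ∃ u : ℍ[ℝ, a, b]ˣ, ∀ x, f x = u * x * (u⁻¹ : ℍ[ℝ, a, b]ˣ) := by
  -- Skolem–Noether: after splitting, automorphisms of an endomorphism algebra are inner.
  let e : ℍ[ℝ, a, b] ≃ₐ[ℝ] Module.End ℝ (Fin 2 → ℝ) :=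
    (splitEquiv ha hb).trans Matrix.toLinAlgEquiv'
  let g : ℍ[ℝ, a, b] ≃ₐ[ℝ] ℍ[ℝ, a, b] := AlgEquiv.ofBijective f
    ⟨hf, (LinearMap.injective_iff_surjective (f := f.toLinearMap)).mp hf⟩
  obtain ⟨T, hT⟩ := (e.symm.trans (g.trans e)).eq_linearEquivConjAlgEquiv
  have h1 : e.symm T.toLinearMap * e.symm T.symm.toLinearMap = 1 := by
    rw [← map_mul, ← map_one e.symm]; congr 1; ext; simp
  have h2 : e.symm T.symm.toLinearMap * e.symm T.toLinearMap = 1 := by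
    rw [← map_mul, ← map_one e.symm]; congr 1; ext; simp
  refine ⟨⟨e.symm T.toLinearMap, e.symm T.symm.toLinearMap, h1, h2⟩, fun x => ?_⟩
  apply e.injective
  have := DFunLike.congr_fun hT (e x)
  simp only [AlgEquiv.trans_apply, AlgEquiv.symm_apply_apply] at this
  change e (g x) = _
  rw [this]
  simp only [Units.inv_mk, map_mul, AlgEquiv.apply_symm_apply]
  ext; simp [LinearEquiv.conjAlgEquiv_apply]

/-- Every orientation preserving isometry of the pure quaternions is the conjugation by an
invertible quaternion. -/
theorem exists_adM_eq (ha : 0 < a) (hb : 0 < b) {A : Matrix (Fin 3) (Fin 3) ℝ}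
    (hA : Aᵀ * pureForm a b * A = pureForm a b) (hdet : A.det = 1) :
    ∃ u : ℍ[ℝ, a, b]ˣ, adM (u : ℍ[ℝ, a, b]) = nrd (u : ℍ[ℝ, a, b]) • A := by
  -- The last row of the adjugate is the cross product of the first two columns of A. This identity
  -- therefore says that the images of i and j multiply to the image of k, so that A extends to an
  -- algebra endomorphism.
  have hadj : pureForm a b * A.adjugate = Aᵀ * pureForm a b := by
    have := congrArg (· * A.adjugate) hA
    simp only [Matrix.mul_assoc, mul_adjugate, hdet, one_smul, Matrix.mul_one] at this
    exact this.symm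
  have hadj' : ∀ i j, (pureForm a b * A.adjugate) i j = (Aᵀ * pureForm a b) i j := fun i j => by
    rw [hadj]
  have h00 := congrFun (congrFun hA 0) 0
  have h01 := congrFun (congrFun hA 0) 1
  have h11 := congrFun (congrFun hA 1) 1
  have k0 := hadj' 2 0
  have k1 := hadj' 2 1
  have k2 := hadj' 2 2
  simp only [pureForm, adjugate_fin_three, Matrix.mul_apply, Fin.sum_univ_three, diagonal,
    Matrix.of_apply, Matrix.transpose_apply, Matrix.cons_val, Fin.isValue, Fin.reduceEq,
    if_true, if_false, mul_zero, zero_mul, add_zero, zero_add] at h00 h01 h11 k0 k1 k2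
  let B : QuaternionAlgebra.Basis ℍ[ℝ, a, b] a 0 b :=
    { i := ⟨0, A 0 0, A 1 0, A 2 0⟩
      j := ⟨0, A 0 1, A 1 1, A 2 1⟩
      k := ⟨0, A 0 2, A 1 2, A 2 2⟩
      i_mul_i := by
        ext <;> simp <;> linarith
      j_mul_j := by
        ext <;> simp <;> linarith
      i_mul_j := by
        ext
        · simp; linarith
        · simp; apply mul_left_cancel₀ ha.ne'; linarith
        · simp; apply mul_left_cancel₀ hb.ne'; linarith
        · simp; apply mul_left_cancel₀ (mul_pos ha hb).ne'; linarith
      j_mul_i := by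
        ext
        · simp; linarith
        · simp; apply mul_left_cancel₀ ha.ne'; linarith
        · simp; apply mul_left_cancel₀ hb.ne'; linarith
        · simp; apply mul_left_cancel₀ (mul_pos ha hb).ne'; linarith }
  have hB : ∀ (x : ℝ) (v : Fin 3 → ℝ), B.liftHom (⟨x, v 0, v 1, v 2⟩ : ℍ[ℝ, a, b]) =
      ⟨x, (A *ᵥ v) 0, (A *ᵥ v) 1, (A *ᵥ v) 2⟩ := by
    intro x v
    ext <;> simp [B, QuaternionAlgebra.Basis.lift, Matrix.mulVec, dotProduct,
      Fin.sum_univ_three] <;> ring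
  have hinj : Function.Injective B.liftHom := by
    rw [injective_iff_map_eq_zero]
    intro q hq
    have h1 := hB q.re ![q.imI, q.imJ, q.imK]
    simp only [Matrix.cons_val] at h1
    rw [hq, QuaternionAlgebra.ext_iff] at h1
    obtain ⟨e0, e1, e2, e3⟩ := h1
    have h2 : A *ᵥ ![q.imI, q.imJ, q.imK] = 0 := by
      ext i; fin_cases i
      exacts [e1.symm, e2.symm, e3.symm]
    have h3 : ![q.imI, q.imJ, q.imK] = 0 :=
      Matrix.eq_zero_of_mulVec_eq_zero (by rw [hdet]; exact one_ne_zero) h2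
    ext
    exacts [e0.symm, congrFun h3 0, congrFun h3 1, congrFun h3 2]
  obtain ⟨u, hu⟩ := exists_unit_conj ha hb B.liftHom hinj
  refine ⟨u, ?_⟩
  have key : ∀ v : Fin 3 → ℝ, adM (u : ℍ[ℝ, a, b]) *ᵥ v = nrd (u : ℍ[ℝ, a, b]) • (A *ᵥ v) := by
    intro v
    have h1 := hu ⟨0, v 0, v 1, v 2⟩
    rw [hB, coe_inv_eq, mul_smul_comm, mul_pure_mul_star] at h1
    have h2 := congrArg (nrd (u : ℍ[ℝ, a, b]) • ·) h1
    simp only [smul_smul, mul_inv_cancel₀ (nrd_ne_zero u), one_smul,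
      QuaternionAlgebra.ext_iff] at h2
    obtain ⟨-, e1, e2, e3⟩ := h2
    ext i; fin_cases i
    exacts [e1.symm, e2.symm, e3.symm]
  apply Matrix.ext_of_mulVec_single
  intro i
  rw [key, Matrix.smul_mulVec]

end RealQuaternions

/-! ### Real structures and conjugates of PO(1,2) -/

section RealStructures

/-- Complex conjugation on `PGL₃(ℂ)`. -/
noncomputable abbrev conjPGL : PGL(3, ℂ) →* PGL(3, ℂ) := ProjGenLinGroup.map (starRingEnd ℂ)

theorem conjPGL_of_mem_PO12 {g : PGL(3, ℂ)} (hg : g ∈ PO12) : conjPGL g = g := by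
  obtain ⟨O, -, rfl⟩ := hg
  simp only [conjPGL, MonoidHom.comp_apply, ProjGenLinGroup.map_mk]
  congr 1
  ext i j
  simp

/-- The class c (conj c)⁻¹ is complex conjugation transported by c. Preserving this real structure
is an equation in PGL₃(ℂ) with the same shape as the one defining `stabY`. -/
theorem conj_stabilizes {c g : PGL(3, ℂ)} (hg : g ∈ conjPO12 c) :
    g * (c * (conjPGL c)⁻¹) = (c * (conjPGL c)⁻¹) * conjPGL g := by
  obtain ⟨g, h0, rfl⟩ := hg
  simp only [MulEquiv.coe_toMonoidHom, MulAut.conj_apply, map_mul, map_inv,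
    conjPGL_of_mem_PO12 h0]
  group

theorem PO12_le_PU12 : PO12 ≤ PU12 := by
  rintro _ ⟨O, hO, rfl⟩
  exact ⟨_, hO, rfl⟩

theorem conjPO12_le_PU12 {c : PGL(3, ℂ)} (hc : c ∈ PU12) : conjPO12 c ≤ PU12 := by
  rintro _ ⟨g, hg, rfl⟩
  exact mul_mem (mul_mem hc (PO12_le_PU12 hg)) (inv_mem hc)

theorem mem_U12_iff {X : GL (Fin 3) ℂ} : X ∈ U12 ↔ X.1ᴴ * formMatrix ℂ * X.1 = formMatrix ℂ :=
  Iff.rfl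

theorem mem_O12_iff {X : GL (Fin 3) ℝ} : X ∈ O12 ↔ X.1ᵀ * formMatrix ℝ * X.1 = formMatrix ℝ := by
  have hF : formMatrix ℂ = (formMatrix ℝ).map Complex.ofRealHom := by
    ext i j; fin_cases i <;> fin_cases j <;> simp [formMatrix]
  have hX : (X.1.map Complex.ofRealHom)ᴴ = X.1ᵀ.map Complex.ofRealHom := by
    ext i j; simp
  have hv : (GeneralLinearGroup.map Complex.ofRealHom X).1 = X.1.map Complex.ofRealHom := rfl
  rw [O12, Subgroup.mem_comap, mem_U12_iff, hv, hX, hF, ← Matrix.map_mul, ← Matrix.map_mul]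
  exact (Matrix.map_injective Complex.ofReal_injective).eq_iff

/-- A projective unitary transformation commuting with the standard real structure is real. -/
theorem mem_PO12_of_conj_eq {g : PGL(3, ℂ)} (hg : g ∈ PU12) (h : conjPGL g = g) : g ∈ PO12 := by
  obtain ⟨B, hB, rfl⟩ := hg
  obtain ⟨l, hl0, hl⟩ := exists_smul_of_mk_eq_mk h.symm
  have hl' : ∀ i j, conj (B.1 i j) = l * B.1 i j := fun i j => congrFun (congrFun hl i) j
  obtain ⟨i, j, hij⟩ : ∃ i j, B.1 i j ≠ 0 := by
    by_contra! h0
    exact B.ne_zero (by ext i j; exact h0 i j)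
  have hnorm : ‖l‖ = 1 := by
    have := congrArg norm (hl' i j)
    rw [RCLike.norm_conj, norm_mul] at this
    have hp : 0 < ‖B.1 i j‖ := norm_pos_iff.mpr hij
    field_simp at this
    exact this.symm
  -- As |m| = 1 and conj B = m² B, the matrix m B is equal to its conjugate, hence real.
  obtain ⟨m, hm⟩ := IsAlgClosed.exists_pow_nat_eq l (n := 2) two_pos
  have hm1 : ‖m‖ = 1 := by
    have : ‖m‖ ^ 2 = 1 := by rw [← norm_pow, hm, hnorm]
    exact (pow_eq_one_iff_of_nonneg (norm_nonneg _) two_ne_zero).mp this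
  have hm2 : conj m * m = 1 := by rw [mul_comm, Complex.mul_conj']; simp [hm1]
  have hm0 : m ≠ 0 := by rintro rfl; simp at hm1
  let O : Matrix (Fin 3) (Fin 3) ℝ := Matrix.of fun i j => (m * B.1 i j).re
  have hO : O.map Complex.ofRealHom = m • B.1 := by
    ext i j
    have : conj (m * B.1 i j) = m * B.1 i j := by
      rw [map_mul, hl', ← hm]; linear_combination (m * B.1 i j) * hm2
    simpa [O] using Complex.conj_eq_iff_re.mp this
  have hdet : O.det ≠ 0 := by
    intro h0
    have h1 : (O.map Complex.ofRealHom).det = 0 := by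
      have := RingHom.map_det Complex.ofRealHom O
      rw [h0, map_zero] at this
      exact this.symm
    rw [hO, det_smul] at h1
    have := (B.isUnit.map Matrix.detMonoidHom).ne_zero
    simp [hm0] at h1
    exact this h1
  let G : GL (Fin 3) ℝ := GeneralLinearGroup.mkOfDetNeZero O hdet
  have hG : (GeneralLinearGroup.map Complex.ofRealHom G).1 = m • B.1 := hO
  refine ⟨G, ?_, ?_⟩
  · change GeneralLinearGroup.map Complex.ofRealHom G ∈ U12
    have hB' := mem_U12_iff.mp hB
    rw [mem_U12_iff, hG, conjTranspose_smul, Matrix.smul_mul, Matrix.smul_mul, Matrix.mul_smul, smul_smul, hB', RCLike.star_def, hm2,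
      one_smul]
  · exact (mk_eq_mk_of_smul hm0 hG).symm

theorem mem_conjPO12_of_stabilizes {c g : PGL(3, ℂ)} (hc : c ∈ PU12) (hg : g ∈ PU12)
    (h : g * (c * (conjPGL c)⁻¹) = (c * (conjPGL c)⁻¹) * conjPGL g) : g ∈ conjPO12 c := by
  refine ⟨c⁻¹ * g * c, mem_PO12_of_conj_eq (mul_mem (mul_mem (inv_mem hc) hg) hc) ?_, ?_⟩
  · have h2 : conjPGL g = conjPGL c * c⁻¹ * g * c * (conjPGL c)⁻¹ := by
      calc conjPGL g = (c * (conjPGL c)⁻¹)⁻¹ * ((c * (conjPGL c)⁻¹) * conjPGL g) := by group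
        _ = _ := by rw [← h]; group
    simp only [map_mul, map_inv, h2]
    group
  · simp only [MulEquiv.coe_toMonoidHom, MulAut.conj_apply]
    group

end RealStructures

/-! ### Pure quaternions as a model of the real plane -/

section Model

noncomputable section

/-- The adjoint representation of the multiplicative group of a quaternion algebra. -/
def adGL {a b : ℝ} : ℍ[ℝ, a, b]ˣ →* GL (Fin 3) ℝ :=
  Units.map { toFun := adM, map_one' := adM_one, map_mul' := adM_mul }

@[simp]
theorem coe_adGL {a b : ℝ} (u : ℍ[ℝ, a, b]ˣ) : (adGL u).1 = adM (u : ℍ[ℝ, a, b]) := rfl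

variable (a b : ℝ)

/-- A matrix of `U(1,2)` mapping `ℝ³` to the real points of the real structure `z ↦ Y conj z`. -/
def frame (ha : 0 < a) : GL (Fin 3) ℂ :=
  GeneralLinearGroup.mkOfDetNeZero
    !![(1 - Complex.I) / (2 * (√a : ℝ)), 0, (1 + Complex.I) / (2 * (√a : ℝ));
      0, 1, 0;
      (√a : ℝ) * (1 + Complex.I) / 2, 0, (√a : ℝ) * (1 - Complex.I) / 2] (by
    have h : ((√a : ℝ) : ℂ) ≠ 0 := by
      exact_mod_cast (Real.sqrt_pos.mpr ha).ne'
    rw [det_fin_three]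
    simp
    field_simp
    ring_nf
    simp)

/-- A similarity from the pure quaternions to `ℝ³` with the restriction of `h`. -/
def realFrame (ha : 0 < a) (hb : 0 < b) : GL (Fin 3) ℝ :=
  GeneralLinearGroup.mkOfDetNeZero !![-(√a * √b), 0, √a * b; 0, b, 0; √a * √b, 0, √a * b] (by
    have h : √a ≠ 0 := (Real.sqrt_pos.mpr ha).ne'
    have h' : √b ≠ 0 := (Real.sqrt_pos.mpr hb).ne'
    rw [det_fin_three]
    simp
    ring_nf
    simp [h, h', hb.ne'])

theorem realFrame_isometry (ha : 0 < a) (hb : 0 < b) :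
    (realFrame a b ha hb).1ᵀ * formMatrix ℝ * (realFrame a b ha hb).1 = b • pureForm a b := by
  have h1 := Real.mul_self_sqrt ha.le
  have h2 := Real.mul_self_sqrt hb.le
  ext i j
  fin_cases i <;> fin_cases j <;>
    simp [realFrame, GeneralLinearGroup.mkOfDetNeZero, formMatrix, pureForm, Matrix.mul_apply,
      Fin.sum_univ_three, diagonal]
  · linear_combination (√b * √b) * h1 + a * h2
  · linear_combination -(b ^ 2) * h1

theorem frame_mem_U12 (ha : 0 < a) : frame a ha ∈ U12 := by
  have h1 : ((√a : ℝ) : ℂ) ≠ 0 := by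
    exact_mod_cast (Real.sqrt_pos.mpr ha).ne'
  have hI := Complex.I_sq
  rw [mem_U12_iff]
  ext i j
  fin_cases i <;> fin_cases j <;>
    simp [frame, GeneralLinearGroup.mkOfDetNeZero, formMatrix, Matrix.mul_apply,
      Fin.sum_univ_three, conjTranspose_apply] <;> field_simp <;>
      simp only [map_ofNat] <;> ring_nf <;> simp [hI] <;> norm_num

theorem Y_mul_conj_frame (ha : 0 < a) (ha' : (a : ℂ) ≠ 0) :
    Y (a : ℂ) ha' * GeneralLinearGroup.map (starRingEnd ℂ) (frame a ha) = frame a ha := by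
  have h0 : ((√a : ℝ) : ℂ) ≠ 0 := by
    exact_mod_cast (Real.sqrt_pos.mpr ha).ne'
  have h1 : ((√a : ℝ) : ℂ) * (√a : ℝ) = a := by
    exact_mod_cast Real.mul_self_sqrt ha.le
  apply Units.ext
  ext i j
  fin_cases i <;> fin_cases j <;>
    simp [frame, Y, GeneralLinearGroup.mkOfDetNeZero, Matrix.mul_apply,
      Fin.sum_univ_three] <;> field_simp <;> (try rw [← h1]) <;>
      simp only [map_ofNat] <;> ring_nf

theorem mk_Y_eq (ha : 0 < a) (ha' : (a : ℂ) ≠ 0) :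
    ProjGenLinGroup.mk (Y (a : ℂ) ha') =
      ProjGenLinGroup.mk (frame a ha) * (conjPGL (ProjGenLinGroup.mk (frame a ha)))⁻¹ := by
  rw [eq_mul_inv_iff_mul_eq, conjPGL, ProjGenLinGroup.map_mk, ← map_mul, Y_mul_conj_frame]

/-- The basis of the real points of the real structure `z ↦ Y conj z` corresponding to the
pure quaternions `i, j, k`. -/
def pureFrame (ha : 0 < a) (hb : 0 < b) : GL (Fin 3) ℂ :=
  frame a ha * GeneralLinearGroup.map Complex.ofRealHom (realFrame a b ha hb)

/-- The columns of `realFrame` are scaled so that √a disappears here and √b survives only in I√b, a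
square root of -b. This is why |D_K| is the second parameter of the algebra. -/
theorem coe_pureFrame (ha : 0 < a) (hb : 0 < b) :
    (pureFrame a b ha hb).1 = !![Complex.I * (√b : ℝ), 0, b; 0, b, 0;
      -(a * (Complex.I * (√b : ℝ))), 0, a * b] := by
  have h0 : ((√a : ℝ) : ℂ) ≠ 0 := by
    exact_mod_cast (Real.sqrt_pos.mpr ha).ne'
  have h1 : ((√a : ℝ) : ℂ) * (√a : ℝ) = a := by
    exact_mod_cast Real.mul_self_sqrt ha.le
  ext i j
  fin_cases i <;> fin_cases j <;>
    simp [pureFrame, frame, realFrame, GeneralLinearGroup.mkOfDetNeZero, Matrix.mul_apply,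
      Fin.sum_univ_three] <;> field_simp <;> (try rw [← h1]) <;> ring_nf

/-- A multiple of the inverse of `pureFrame`. -/
def pureFrameAdj : Matrix (Fin 3) (Fin 3) ℂ :=
  !![-(a * (Complex.I * (√b : ℝ))), 0, Complex.I * (√b : ℝ); 0, 2 * a, 0; a, 0, 1]

theorem pureFrame_mul_adj (ha : 0 < a) (hb : 0 < b) :
    (pureFrame a b ha hb).1 * pureFrameAdj a b = (2 * a * b : ℂ) • 1 := by
  have h1 : (Complex.I * (√b : ℝ)) * (Complex.I * (√b : ℝ)) = -(b : ℂ) := by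
    have : ((√b : ℝ) : ℂ) * (√b : ℝ) = b := by exact_mod_cast Real.mul_self_sqrt hb.le
    linear_combination (((√b : ℝ) : ℂ) * (√b : ℝ)) * Complex.I_mul_I - this
  rw [coe_pureFrame, pureFrameAdj]
  generalize Complex.I * (√b : ℝ) = d at h1
  ext i j
  fin_cases i <;> fin_cases j <;>
    simp [Matrix.mul_apply, Fin.sum_univ_three]
  · linear_combination -(a : ℂ) * h1
  · linear_combination h1
  · ring
  · linear_combination (a ^ 2 : ℂ) * h1
  · linear_combination -(a : ℂ) * h1

/-- The homomorphism from the multiplicative group of the real quaternion algebra to `PU(1,2)`. -/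
def projAd (ha : 0 < a) (hb : 0 < b) : ℍ[ℝ, a, b]ˣ →* PGL(3, ℂ) :=
  (MulAut.conj (ProjGenLinGroup.mk (pureFrame a b ha hb))).toMonoidHom.comp
    (ProjGenLinGroup.mk.comp ((GeneralLinearGroup.map Complex.ofRealHom).comp adGL))

theorem projAd_apply (ha : 0 < a) (hb : 0 < b) (u : ℍ[ℝ, a, b]ˣ) :
    projAd a b ha hb u = ProjGenLinGroup.mk (pureFrame a b ha hb *
      GeneralLinearGroup.map Complex.ofRealHom (adGL u) * (pureFrame a b ha hb)⁻¹) := by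
  simp [projAd]

theorem projAd_eq_conj (ha : 0 < a) (hb : 0 < b) (u : ℍ[ℝ, a, b]ˣ) :
    projAd a b ha hb u = MulAut.conj (ProjGenLinGroup.mk (frame a ha))
      (ProjGenLinGroup.mk (GeneralLinearGroup.map Complex.ofRealHom
        (realFrame a b ha hb * adGL u * (realFrame a b ha hb)⁻¹))) := by
  simp only [projAd, pureFrame, MonoidHom.comp_apply, MulEquiv.coe_toMonoidHom, MulAut.conj_apply,
    map_mul, map_inv, MulAut.mul_apply]

variable {a b}

theorem inv_isometry {F : Type*} [Field F] {R : GL (Fin 3) F} {Q Q' : Matrix (Fin 3) (Fin 3) F}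
    (h : R.1ᵀ * Q * R.1 = Q') : (R⁻¹).1ᵀ * Q' * (R⁻¹).1 = Q := by
  have h1 : R.1 * (R⁻¹).1 = 1 := R.mul_inv
  have h2 : (R⁻¹).1ᵀ * R.1ᵀ = 1 := by rw [← transpose_mul, h1, transpose_one]
  calc _ = ((R⁻¹).1ᵀ * R.1ᵀ) * Q * (R.1 * (R⁻¹).1) := by
        rw [← h]; simp only [Matrix.mul_assoc]
    _ = Q := by rw [h1, h2, Matrix.one_mul, Matrix.mul_one]

theorem mul_isometry {F : Type*} [Field F] {A B : Matrix (Fin 3) (Fin 3) F}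
    {Q Q' Q'' : Matrix (Fin 3) (Fin 3) F}
    (h : Aᵀ * Q * A = Q') (h' : Bᵀ * Q' * B = Q'') : (A * B)ᵀ * Q * (A * B) = Q'' := by
  rw [transpose_mul, ← h', ← h]; simp only [Matrix.mul_assoc]

/-- Dividing `adM u` by the norm of u gives an isometry. Conversely, in dimension three -1 has
determinant -1 and is projectively trivial, so a real isometry may be multiplied by its determinant
and `exists_adM_eq` applies. -/
theorem range_projAd (ha : 0 < a) (hb : 0 < b) :
    (projAd a b ha hb).range = conjPO12 (ProjGenLinGroup.mk (frame a ha)) := by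
  have hR := realFrame_isometry a b ha hb
  have hR' := inv_isometry hR
  apply le_antisymm
  · rintro _ ⟨u, rfl⟩
    have hn := nrd_ne_zero u
    rw [projAd_eq_conj]
    set W : GL (Fin 3) ℝ := realFrame a b ha hb * adGL u * (realFrame a b ha hb)⁻¹ with hW
    have h1 : (adGL u).1ᵀ * (b • pureForm a b) * (adGL u).1 =
        nrd (u : ℍ[ℝ, a, b]) ^ 2 • (b • pureForm a b) := by
      rw [coe_adGL, Matrix.mul_smul, Matrix.smul_mul, adM_isometry, smul_comm]
    have h2 : W.1ᵀ * formMatrix ℝ * W.1 = nrd (u : ℍ[ℝ, a, b]) ^ 2 • formMatrix ℝ := by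
      refine mul_isometry (mul_isometry hR h1) ?_
      rw [Matrix.mul_smul, Matrix.smul_mul, hR']
    let O : GL (Fin 3) ℝ :=
      GeneralLinearGroup.scalar (Fin 3) (Units.mk0 (nrd (u : ℍ[ℝ, a, b])) hn)⁻¹ * W
    have hO : O.1 = (nrd (u : ℍ[ℝ, a, b]))⁻¹ • W.1 := by
      rw [Units.val_mul, GeneralLinearGroup.coe_scalar, scalar_apply, ← smul_eq_diagonal_mul]
      rfl
    refine ⟨_, ⟨O, ?_, rfl⟩, ?_⟩
    · change O ∈ O12
      rw [mem_O12_iff, hO, transpose_smul, Matrix.smul_mul, Matrix.smul_mul, Matrix.mul_smul, h2, smul_smul, smul_smul]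
      field_simp
      simp
    · change MulAut.conj _ _ = _
      congr 1
      symm
      refine mk_eq_mk_of_smul (c := ((nrd (u : ℍ[ℝ, a, b]))⁻¹ : ℝ)) (by simpa using hn) ?_
      ext i j
      simp [hO]
  · rintro _ ⟨_, ⟨O, hO, rfl⟩, rfl⟩
    have hO' := mem_O12_iff.mp hO
    have hF : (formMatrix ℝ).det ≠ 0 := by rw [det_fin_three]; simp [formMatrix]
    have hdet : O.1.det ^ 2 = 1 := by
      have := congrArg Matrix.det hO'
      rw [det_mul, det_mul, det_transpose] at this
      apply mul_left_cancel₀ hF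
      linear_combination this
    set W : GL (Fin 3) ℝ := (realFrame a b ha hb)⁻¹ * O * realFrame a b ha hb with hW
    have h1 : W.1ᵀ * (b • pureForm a b) * W.1 = b • pureForm a b :=
      mul_isometry (mul_isometry hR' hO') hR
    have h2 : W.1ᵀ * pureForm a b * W.1 = pureForm a b := by
      rw [Matrix.mul_smul, Matrix.smul_mul] at h1
      exact smul_right_injective _ hb.ne' h1
    have h3 : W.1.det = O.1.det := by
      have h4 : (realFrame a b ha hb)⁻¹.1.det * (realFrame a b ha hb).1.det = 1 := by
        rw [← det_mul, Units.inv_mul, det_one]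
      rw [hW, Units.val_mul, Units.val_mul, det_mul, det_mul]
      linear_combination O.1.det * h4
    obtain ⟨u, hu⟩ := exists_adM_eq ha hb (A := O.1.det • W.1) (by
      rw [transpose_smul, Matrix.smul_mul, Matrix.smul_mul, Matrix.mul_smul, h2, smul_smul, ← sq, hdet, one_smul]) (by
      rw [det_smul, h3, Fintype.card_fin]; linear_combination (O.1.det ^ 2 + 1) * hdet)
    have hd0 : O.1.det ≠ 0 := by intro h; rw [h] at hdet; norm_num at hdet
    refine ⟨u, ?_⟩
    rw [projAd_eq_conj]
    change MulAut.conj _ _ = MulAut.conj _ _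
    congr 1
    symm
    refine mk_eq_mk_of_smul (c := ((nrd (u : ℍ[ℝ, a, b]) * O.1.det : ℝ) : ℂ))
      (by exact_mod_cast mul_ne_zero (nrd_ne_zero u) hd0) ?_
    have h5 : (realFrame a b ha hb * adGL u * (realFrame a b ha hb)⁻¹).1 =
        (nrd (u : ℍ[ℝ, a, b]) * O.1.det) • O.1 := by
      have h6 : (realFrame a b ha hb).1 * (realFrame a b ha hb)⁻¹.1 = 1 := Units.mul_inv _
      rw [Units.val_mul, Units.val_mul, coe_adGL, hu, smul_smul, Matrix.mul_smul, Matrix.smul_mul, hW,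
        Units.val_mul, Units.val_mul]
      congr 1
      calc _ = ((realFrame a b ha hb).1 * (realFrame a b ha hb)⁻¹.1) * O.1 *
            ((realFrame a b ha hb).1 * (realFrame a b ha hb)⁻¹.1) := by
            simp only [Matrix.mul_assoc]
        _ = O.1 := by rw [h6, Matrix.one_mul, Matrix.mul_one]
    change (realFrame a b ha hb * adGL u * (realFrame a b ha hb)⁻¹).1.map _ = _ • O.1.map _
    rw [h5]
    ext i j
    simp

end

end Model

/-! ### The norm one group and the identity component -/

section NormOne

noncomputable section

theorem mem_unitary_iff_nrd {a b : ℝ} {q : ℍ[ℝ, a, b]} :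
    q ∈ unitary ℍ[ℝ, a, b] ↔ nrd q = 1 := by
  rw [Unitary.mem_iff, star_mul_eq_nrd, mul_star_eq_nrd, and_self]
  constructor
  · intro h
    simpa using congrArg QuaternionAlgebra.re h
  · intro h
    rw [h]; rfl

theorem projAd_eq_of_smul {a b : ℝ} (ha : 0 < a) (hb : 0 < b) {u v : ℍ[ℝ, a, b]ˣ} {c : ℝ}
    (hc : c ≠ 0) (h : (v : ℍ[ℝ, a, b]) = c • (u : ℍ[ℝ, a, b])) :
    projAd a b ha hb v = projAd a b ha hb u := by
  simp only [projAd, MonoidHom.comp_apply]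
  congr 1
  symm
  refine mk_eq_mk_of_smul (c := ((c ^ 2 : ℝ) : ℂ)) (by exact_mod_cast pow_ne_zero 2 hc) ?_
  ext i j
  simp [h, adM_smul]

theorem projAd_eq_one_iff {a b : ℝ} (ha : 0 < a) (hb : 0 < b) (u : ℍ[ℝ, a, b]ˣ) :
    projAd a b ha hb u = 1 ↔ (u : ℍ[ℝ, a, b]).imI = 0 ∧ (u : ℍ[ℝ, a, b]).imJ = 0 ∧
      (u : ℍ[ℝ, a, b]).imK = 0 := by
  simp only [projAd, MonoidHom.comp_apply]
  rw [MulEquiv.coe_toMonoidHom, EmbeddingLike.map_eq_one_iff, eq_comm, ← ProjGenLinGroup.mk_one]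
  constructor
  · intro h
    obtain ⟨c, hc, h⟩ := exists_smul_of_mk_eq_mk h
    have e : ∀ i j, ((adM (u : ℍ[ℝ, a, b]) i j : ℝ) : ℂ) = c * (1 : Matrix (Fin 3) (Fin 3) ℂ) i j :=
      fun i j => congrFun (congrFun h i) j
    -- Equality of the diagonal entries makes sums of nonnegative terms vanish, one for each pure
    -- coordinate.
    have h02 : adM (u : ℍ[ℝ, a, b]) 0 0 = adM (u : ℍ[ℝ, a, b]) 2 2 := by
      have := (e 0 0).trans (e 2 2).symm
      exact_mod_cast this
    have h12 : adM (u : ℍ[ℝ, a, b]) 1 1 = adM (u : ℍ[ℝ, a, b]) 2 2 := by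
      have := (e 1 1).trans (e 2 2).symm
      exact_mod_cast this
    simp only [adM, Matrix.of_apply, Matrix.cons_val] at h02 h12
    have hx : 0 ≤ a * (u : ℍ[ℝ, a, b]).imI ^ 2 := by positivity
    have hy : 0 ≤ b * (u : ℍ[ℝ, a, b]).imJ ^ 2 := by positivity
    have hz : 0 ≤ a * b * (u : ℍ[ℝ, a, b]).imK ^ 2 := by positivity
    have ex : a * (u : ℍ[ℝ, a, b]).imI ^ 2 = 0 := by linarith
    have ey : b * (u : ℍ[ℝ, a, b]).imJ ^ 2 = 0 := by linarith
    have ez : a * b * (u : ℍ[ℝ, a, b]).imK ^ 2 = 0 := by linarith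
    simp only [mul_eq_zero, ha.ne', hb.ne', false_or, or_false, pow_eq_zero_iff two_ne_zero] at ex ey ez
    exact ⟨ex, ey, ez⟩
  · rintro ⟨hx, hy, hz⟩
    have hu : (u : ℍ[ℝ, a, b]) = ((u : ℍ[ℝ, a, b]).re : ℍ[ℝ, a, b]) := by
      ext <;> simp [hx, hy, hz]
    have h0 : (u : ℍ[ℝ, a, b]).re ≠ 0 := by
      intro h0
      rw [h0] at hu
      exact u.ne_zero hu
    refine mk_eq_mk_of_smul (c := (((u : ℍ[ℝ, a, b]).re ^ 2 : ℝ) : ℂ))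
      (by exact_mod_cast pow_ne_zero 2 h0) ?_
    change (adM (u : ℍ[ℝ, a, b])).map _ = _
    rw [hu, adM_coe]
    ext i j
    simp only [Matrix.map_apply, Matrix.smul_apply, Units.val_one, Matrix.one_apply, smul_eq_mul]
    split_ifs <;> simp

variable {a b : ℤ}

/-- The homomorphism from the group of real quaternions of norm `1` to `PU(1,2)`. -/
def normOneHom (ha : 0 < (a : ℝ)) (hb : 0 < (b : ℝ)) : NormOne a b →* PGL(3, ℂ) :=
  (projAd (a : ℝ) (b : ℝ) ha hb).comp Unitary.toUnits

theorem normOneHom_apply (ha : 0 < (a : ℝ)) (hb : 0 < (b : ℝ)) (x : NormOne a b) :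
    normOneHom ha hb x = projAd (a : ℝ) (b : ℝ) ha hb (Unitary.toUnits x) := rfl

theorem exists_normOne_of_nrd_pos (ha : 0 < (a : ℝ)) (hb : 0 < (b : ℝ))
    (u : (QuatPoints ℝ a b)ˣ) (hu : 0 < nrd (u : QuatPoints ℝ a b)) :
    ∃ x : NormOne a b, normOneHom ha hb x = projAd (a : ℝ) (b : ℝ) ha hb u := by
  have hs : √(nrd (u : QuatPoints ℝ a b)) ≠ 0 := (Real.sqrt_pos.mpr hu).ne'
  refine ⟨⟨(√(nrd (u : QuatPoints ℝ a b)))⁻¹ • (u : QuatPoints ℝ a b), ?_⟩, ?_⟩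
  · rw [mem_unitary_iff_nrd, nrd_smul, inv_pow, Real.sq_sqrt hu.le, inv_mul_cancel₀ hu.ne']
  · exact projAd_eq_of_smul ha hb (inv_ne_zero hs) rfl

theorem mem_center_normOne_iff (ha : 0 < (a : ℝ)) (hb : 0 < (b : ℝ)) (x : NormOne a b) :
    x ∈ Subgroup.center (NormOne a b) ↔ (x : QuatPoints ℝ a b).imI = 0 ∧
      (x : QuatPoints ℝ a b).imJ = 0 ∧ (x : QuatPoints ℝ a b).imK = 0 := by
  rw [Subgroup.mem_center_iff]
  constructor
  · intro h
    -- The elements √(1+a) + i and √(1+b) + j have norm one; commuting with both kills the pure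
    -- part.
    have hi : (⟨√(1 + a), 1, 0, 0⟩ : QuatPoints ℝ a b) ∈ unitary (QuatPoints ℝ a b) := by
      rw [mem_unitary_iff_nrd]
      simp [nrd, Real.sq_sqrt (show (0 : ℝ) ≤ 1 + a by linarith)]
    have hj : (⟨√(1 + b), 0, 1, 0⟩ : QuatPoints ℝ a b) ∈ unitary (QuatPoints ℝ a b) := by
      rw [mem_unitary_iff_nrd]
      simp [nrd, Real.sq_sqrt (show (0 : ℝ) ≤ 1 + b by linarith)]
    have h1 := congrArg Subtype.val (h ⟨_, hi⟩)
    have h2 := congrArg Subtype.val (h ⟨_, hj⟩)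
    simp only [Submonoid.coe_mul, QuaternionAlgebra.ext_iff] at h1 h2
    obtain ⟨-, -, h1j, h1k⟩ := h1
    obtain ⟨-, -, -, h2k⟩ := h2
    simp at h1j h1k h2k
    refine ⟨by linarith, by linarith, ?_⟩
    have : (a : ℝ) * (x : QuatPoints ℝ a b).imK = 0 := by linarith
    simpa [ha.ne'] using this
  · rintro ⟨hx, hy, hz⟩ g
    apply Subtype.ext
    simp only [Submonoid.coe_mul]
    ext <;> simp [hx, hy, hz] <;> ring

theorem ker_normOneHom (ha : 0 < (a : ℝ)) (hb : 0 < (b : ℝ)) :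
    (normOneHom ha hb).ker = Subgroup.center (NormOne a b) := by
  ext x
  rw [MonoidHom.mem_ker, normOneHom_apply, projAd_eq_one_iff, mem_center_normOne_iff ha hb]
  rfl

theorem continuous_normOneHom (ha : 0 < (a : ℝ)) (hb : 0 < (b : ℝ)) :
    Continuous[normOneTopology a b, instTopologicalSpacePGL] (normOneHom ha hb) := by
  let _ : TopologicalSpace (NormOne a b) := normOneTopology a b
  have hc : Continuous fun x : NormOne a b =>
      QuaternionAlgebra.equivTuple _ _ _ (x : QuatPoints ℝ a b) := continuous_induced_dom
  have h0 : Continuous fun x : NormOne a b => (x : QuatPoints ℝ a b).re :=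
    (continuous_apply 0).comp hc
  have h1 : Continuous fun x : NormOne a b => (x : QuatPoints ℝ a b).imI :=
    (continuous_apply 1).comp hc
  have h2 : Continuous fun x : NormOne a b => (x : QuatPoints ℝ a b).imJ :=
    (continuous_apply 2).comp hc
  have h3 : Continuous fun x : NormOne a b => (x : QuatPoints ℝ a b).imK :=
    (continuous_apply 3).comp hc
  have key : Continuous fun x : NormOne a b =>
      GeneralLinearGroup.map Complex.ofRealHom (adGL (Unitary.toUnits x)) := by
    rw [Units.continuous_iff]
    constructor
    · refine Continuous.matrix_map (f := fun r : ℝ => Complex.ofRealHom r) ?_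
        Complex.continuous_ofReal
      refine continuous_matrix fun i j => ?_
      fin_cases i <;> fin_cases j <;> simp [adM] <;> fun_prop
    · have : (fun x : NormOne a b => ((GeneralLinearGroup.map Complex.ofRealHom
          (adGL (Unitary.toUnits x)))⁻¹).1) =
          fun x : NormOne a b => (adM (star (x : QuatPoints ℝ a b))).map Complex.ofRealHom := by
        funext x
        rw [← map_inv, ← map_inv, ← map_inv]
        rfl
      rw [this]
      refine Continuous.matrix_map (f := fun r : ℝ => Complex.ofRealHom r) ?_
        Complex.continuous_ofReal
      refine continuous_matrix fun i j => ?_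
      fin_cases i <;> fin_cases j <;> simp [adM] <;> fun_prop
  have h : (normOneHom ha hb : NormOne a b → PGL(3, ℂ)) = fun x =>
      ProjGenLinGroup.mk (pureFrame (a : ℝ) (b : ℝ) ha hb * GeneralLinearGroup.map Complex.ofRealHom
        (adGL (Unitary.toUnits x)) * (pureFrame (a : ℝ) (b : ℝ) ha hb)⁻¹) := by
    funext x
    rw [normOneHom_apply, projAd_apply]
  rw [h]
  exact continuous_mk.comp ((continuous_const.mul key).mul continuous_const)

/-- A parametrisation of the group of real quaternions of norm `1`. -/
def normOneParam (ha : 0 < (a : ℝ)) (hb : 0 < (b : ℝ)) (p : ℝ × ℝ × ℝ) : NormOne a b :=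
  ⟨⟨√(1 + a * p.2.1 ^ 2 + b * p.2.2 ^ 2) * Real.cos p.1, p.2.1, p.2.2,
      √(1 + a * p.2.1 ^ 2 + b * p.2.2 ^ 2) * Real.sin p.1 / √(a * b)⟩, by
    have h1 : (0 : ℝ) ≤ 1 + a * p.2.1 ^ 2 + b * p.2.2 ^ 2 := by positivity
    have h2 : (0 : ℝ) < a * b := by positivity
    rw [mem_unitary_iff_nrd]
    simp only [nrd, mul_pow, div_pow, Real.sq_sqrt h1, Real.sq_sqrt h2.le]
    field_simp
    linear_combination (1 + a * p.2.1 ^ 2 + b * p.2.2 ^ 2) * Real.cos_sq_add_sin_sq p.1⟩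

theorem continuous_normOneParam (ha : 0 < (a : ℝ)) (hb : 0 < (b : ℝ)) :
    Continuous[inferInstance, normOneTopology a b] (normOneParam ha hb) := by
  refine continuous_induced_rng.mpr (continuous_pi fun i => ?_)
  fin_cases i <;> simp [normOneParam] <;> fun_prop

/-- Norm one reads w² + ab z² = 1 + a x² + b y², so (w, √(ab) z) lies on a circle of radius
determined by (x, y), and the missing parameter is its argument. Connectedness follows. -/
theorem normOneParam_surjective (ha : 0 < (a : ℝ)) (hb : 0 < (b : ℝ)) :
    Function.Surjective (normOneParam ha hb) := by
  rintro ⟨q, hq⟩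
  have hn := mem_unitary_iff_nrd.mp hq
  have h2 : (0 : ℝ) < a * b := by positivity
  have hs : 0 < √((a : ℝ) * b) := Real.sqrt_pos.mpr h2
  let ζ : ℂ := ⟨q.re, √(a * b) * q.imK⟩
  have hζ : ‖ζ‖ = √(1 + a * q.imI ^ 2 + b * q.imJ ^ 2) := by
    rw [Complex.norm_eq_sqrt_sq_add_sq]
    congr 1
    simp only [ζ, mul_pow, Real.sq_sqrt h2.le]
    simp only [nrd] at hn
    linear_combination hn
  refine ⟨(Complex.arg ζ, q.imI, q.imJ), ?_⟩
  apply Subtype.ext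
  simp only [normOneParam]
  rw [← hζ, Complex.norm_mul_cos_arg, Complex.norm_mul_sin_arg]
  ext
  · rfl
  · rfl
  · rfl
  · simp [ζ]; field_simp

theorem isPreconnected_range_normOneHom (ha : 0 < (a : ℝ)) (hb : 0 < (b : ℝ)) :
    IsPreconnected ((normOneHom ha hb).range : Set PGL(3, ℂ)) := by
  have h : ((normOneHom ha hb).range : Set PGL(3, ℂ)) =
      Set.range (normOneHom ha hb ∘ normOneParam ha hb) := by
    rw [(normOneParam_surjective ha hb).range_comp]; rfl
  rw [h]
  exact isPreconnected_range
    (@Continuous.comp _ _ _ _ (normOneTopology a b) _ _ _ (continuous_normOneHom ha hb)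
      (continuous_normOneParam ha hb))

/-- A function separating the two connected components of a conjugate of `PO(1,2)`. -/
def orientation (p g : PGL(3, ℂ)) : ℝ :=
  (Matrix.det (Matrix.of fun i j => adjCoord (p⁻¹ * g * p) ((i, j), (2, 2)))).re

theorem continuous_orientation (p : PGL(3, ℂ)) : Continuous (orientation p) := by
  obtain ⟨P, rfl⟩ := ProjGenLinGroup.mk_surjective p
  refine Complex.continuous_re.comp (Continuous.matrix_det (continuous_matrix fun i j => ?_))
  apply continuous_of_comp_mk
  have h : Continuous fun X : GL (Fin 3) ℂ => P⁻¹ * X * P :=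
    (continuous_const.mul continuous_id).mul continuous_const
  refine ((continuous_apply ((i, j), (2, 2))).comp continuous_adjCoord).comp
    (f := fun X : GL (Fin 3) ℂ => (ProjGenLinGroup.mk P)⁻¹ * ProjGenLinGroup.mk X *
      ProjGenLinGroup.mk P) ?_
  simp only [← map_inv, ← map_mul]
  exact continuous_mk.comp h

theorem orientation_projAd {a b : ℝ} (ha : 0 < a) (hb : 0 < b) (u : ℍ[ℝ, a, b]ˣ) :
    orientation (ProjGenLinGroup.mk (pureFrame a b ha hb)) (projAd a b ha hb u) =
      (adM (u : ℍ[ℝ, a, b]) 2 2 / nrd (u : ℍ[ℝ, a, b])) ^ 3 := by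
  have h1 : (ProjGenLinGroup.mk (pureFrame a b ha hb))⁻¹ * projAd a b ha hb u *
      ProjGenLinGroup.mk (pureFrame a b ha hb) =
      ProjGenLinGroup.mk (GeneralLinearGroup.map Complex.ofRealHom (adGL u)) := by
    simp only [projAd, MonoidHom.comp_apply, MulEquiv.coe_toMonoidHom, MulAut.conj_apply]
    group
  have h2 : ((GeneralLinearGroup.map Complex.ofRealHom (adGL u))⁻¹).1 2 2 =
      ((adM (u : ℍ[ℝ, a, b]) 2 2 / nrd (u : ℍ[ℝ, a, b]) ^ 2 : ℝ) : ℂ) := by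
    rw [← map_inv, ← map_inv]
    change ((adM ((u⁻¹ : ℍ[ℝ, a, b]ˣ) : ℍ[ℝ, a, b]) 2 2 : ℝ) : ℂ) = _
    rw [coe_inv_eq, adM_smul]
    congr 1
    simp [adM]
    ring
  have h3 : (Matrix.of fun i j => adjCoord (ProjGenLinGroup.mk
      (GeneralLinearGroup.map Complex.ofRealHom (adGL u))) ((i, j), (2, 2))) =
      Complex.ofRealHom.mapMatrix
        ((adM (u : ℍ[ℝ, a, b]) 2 2 / nrd (u : ℍ[ℝ, a, b]) ^ 2) • adM (u : ℍ[ℝ, a, b])) := by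
    ext i j
    rw [Matrix.of_apply, adjCoord_mk]
    simp only [h2]
    simp
    ring
  rw [orientation, h1, h3, ← RingHom.map_det, det_smul, det_adM, Fintype.card_fin,
    Complex.ofRealHom_eq_coe, Complex.ofReal_re]
  have := nrd_ne_zero u
  field_simp

/-- This entry is a positive definite form in the four coordinates. By `orientation_projAd`, the
orientation thus has the sign of the reduced norm and never vanishes. -/
theorem adM_two_two_pos {a b : ℝ} (ha : 0 < a) (hb : 0 < b) (u : ℍ[ℝ, a, b]ˣ) :
    0 < adM (u : ℍ[ℝ, a, b]) 2 2 := by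
  have h1 : 0 ≤ adM (u : ℍ[ℝ, a, b]) 2 2 := by
    simp only [adM, Matrix.of_apply, Matrix.cons_val]; positivity
  refine lt_of_le_of_ne h1 fun h => ?_
  apply u.ne_zero
  have hab := mul_pos ha hb
  simp only [adM, Matrix.of_apply, Matrix.cons_val] at h
  have hw : 0 ≤ (u : ℍ[ℝ, a, b]).re ^ 2 := by positivity
  have hx : 0 ≤ a * (u : ℍ[ℝ, a, b]).imI ^ 2 := by positivity
  have hy : 0 ≤ b * (u : ℍ[ℝ, a, b]).imJ ^ 2 := by positivity
  have hz : 0 ≤ a * b * (u : ℍ[ℝ, a, b]).imK ^ 2 := by positivity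
  have ew : (u : ℍ[ℝ, a, b]).re ^ 2 = 0 := by linarith
  have ex : a * (u : ℍ[ℝ, a, b]).imI ^ 2 = 0 := by linarith
  have ey : b * (u : ℍ[ℝ, a, b]).imJ ^ 2 = 0 := by linarith
  have ez : a * b * (u : ℍ[ℝ, a, b]).imK ^ 2 = 0 := by linarith
  simp only [mul_eq_zero, ha.ne', hb.ne', false_or, or_false, pow_eq_zero_iff two_ne_zero]
    at ew ex ey ez
  ext
  exacts [ew, ex, ey, ez]

theorem range_normOneHom (ha : 0 < (a : ℝ)) (hb : 0 < (b : ℝ)) :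
    ((normOneHom ha hb).range : Set PGL(3, ℂ)) = connectedComponentIn
      (conjPO12 (ProjGenLinGroup.mk (frame (a : ℝ) ha)) : Set PGL(3, ℂ)) 1 := by
  have hle : (normOneHom ha hb).range ≤ (projAd (a : ℝ) (b : ℝ) ha hb).range := by
    rintro _ ⟨x, rfl⟩; exact ⟨_, rfl⟩
  rw [← range_projAd ha hb]
  apply Set.Subset.antisymm
  · exact (isPreconnected_range_normOneHom ha hb).subset_connectedComponentIn (one_mem _) hle
  · intro g hg
    obtain ⟨u, rfl⟩ := connectedComponentIn_subset _ _ hg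
    set p := ProjGenLinGroup.mk (pureFrame (a : ℝ) (b : ℝ) ha hb)
    have h1 : (1 : PGL(3, ℂ)) ∈ connectedComponentIn
        ((projAd (a : ℝ) (b : ℝ) ha hb).range : Set PGL(3, ℂ)) 1 :=
      mem_connectedComponentIn (one_mem _)
    have ho1 : orientation p 1 = 1 := by
      have := orientation_projAd ha hb (1 : (QuatPoints ℝ a b)ˣ)
      rw [map_one] at this
      rw [this]; simp
    rcases lt_or_gt_of_ne (nrd_ne_zero u) with hn | hn
    -- A negative norm would give a negative orientation, while the identity has orientation 1; on a
    -- connected set the value 0 would then be taken.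
    · exfalso
      have h2 : orientation p (projAd (a : ℝ) (b : ℝ) ha hb u) < 0 := by
        rw [orientation_projAd]
        exact Odd.pow_neg (by decide) (div_neg_of_pos_of_neg (adM_two_two_pos ha hb u) hn)
      obtain ⟨g, hgC, hg0⟩ := isPreconnected_connectedComponentIn.intermediate_value hg h1
        (continuous_orientation p).continuousOn (show (0 : ℝ) ∈ Set.Icc _ _ from
          ⟨h2.le, by rw [ho1]; exact zero_le_one⟩)
      obtain ⟨v, rfl⟩ := connectedComponentIn_subset _ _ hgC
      rw [orientation_projAd] at hg0
      exact pow_ne_zero 3 (div_ne_zero (adM_two_two_pos ha hb v).ne' (nrd_ne_zero v)) hg0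
    · exact exists_normOne_of_nrd_pos ha hb u hn

end

end NormOne

/-! ### Directions of Pell type acting irreducibly -/

section PellElements

/-- The number lies strictly between (sb)² and (sb + 1)². -/
theorem not_isSquare_sq_add {s b : ℤ} (hs : 0 < s) (hb : 0 < b) :
    ¬ IsSquare (s * s * (b * b) + b) := by
  rintro ⟨m, hm⟩
  have h1 : (s * b) ^ 2 < |m| ^ 2 := by rw [sq_abs]; nlinarith
  have h2 : |m| ^ 2 < (s * b + 1) ^ 2 := by rw [sq_abs]; nlinarith [mul_pos hs hb]
  have h3 : s * b < |m| := lt_of_pow_lt_pow_left₀ 2 (abs_nonneg m) h1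
  have h4 : |m| < s * b + 1 := lt_of_pow_lt_pow_left₀ 2 (by positivity) h2
  omega

theorem not_isSquare_mul_sq {a c : ℤ} (ha : ¬ IsSquare a) (hc : c ≠ 0) :
    ¬ IsSquare (a * c ^ 2) := by
  rintro ⟨m, hm⟩
  have h1 : c ^ 2 ∣ m ^ 2 := ⟨a, by rw [sq m, ← hm]; ring⟩
  obtain ⟨k, rfl⟩ := (Int.pow_dvd_pow_iff two_ne_zero).mp h1
  apply ha
  refine ⟨k, mul_right_cancel₀ (pow_ne_zero 2 hc) ?_⟩
  rw [hm]; ring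

/-- The square of the pure quaternion with the given coordinates. -/
def pureSq {R : Type*} [CommRing R] (a b : R) (t : Fin 3 → R) : R :=
  a * t 0 ^ 2 + b * t 1 ^ 2 - a * b * t 2 ^ 2

/-- The infinitesimal adjoint action over `ℂ` of an integral pure quaternion. -/
def adLInt (a b : ℤ) (t : Fin 3 → ℤ) : Matrix (Fin 3) (Fin 3) ℂ :=
  adL (a : ℂ) b (t 0) (t 1) (t 2)

/-- The pure quaternions `t₁, t₂` generate a subalgebra of the Lie algebra of pure quaternions
which acts irreducibly. -/
structure IrreduciblePair (a b : ℤ) (t₁ t₂ : Fin 3 → ℤ) : Prop where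
  not_eigenvector : ∀ w : Fin 3 → ℂ, w ≠ 0 → ∀ m₁ m₂ : ℂ, adLInt a b t₁ *ᵥ w = m₁ • w →
    adLInt a b t₂ *ᵥ w = m₂ • w → False
  commutant : ∀ Z : Matrix (Fin 3) (Fin 3) ℂ, adLInt a b t₁ * Z = Z * adLInt a b t₁ →
    adLInt a b t₂ * Z = Z * adLInt a b t₂ → ∃ c : ℂ, Z = c • 1

/-- Common eigenvectors and common commutants depend only on the span of the pair, which contains
the sum and the difference. -/
theorem IrreduciblePair.of_linearCombination {a b : ℤ} {t₁ t₂ s₁ s₂ : Fin 3 → ℤ}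
    (h : IrreduciblePair a b s₁ s₂) {m₁ m₂ : ℤ} (h₁ : m₁ ≠ 0) (h₂ : m₂ ≠ 0)
    (e₁ : m₁ • s₁ = t₁ + t₂) (e₂ : m₂ • s₂ = t₁ - t₂) : IrreduciblePair a b t₁ t₂ := by
  have c₁ : (m₁ : ℂ) ≠ 0 := by exact_mod_cast h₁
  have c₂ : (m₂ : ℂ) ≠ 0 := by exact_mod_cast h₂
  have l₁ : adLInt a b s₁ = (m₁ : ℂ)⁻¹ • (adLInt a b t₁ + adLInt a b t₂) := by
    rw [eq_inv_smul_iff₀ c₁]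
    have e : ∀ i, (m₁ : ℂ) * s₁ i = t₁ i + t₂ i := fun i => by
      exact_mod_cast congrFun e₁ i
    ext i j
    fin_cases i <;> fin_cases j <;> simp [adLInt, adL]
    · linear_combination (b : ℂ) * e 2
    · linear_combination -(b : ℂ) * e 1
    · linear_combination -(a : ℂ) * e 2
    · linear_combination (a : ℂ) * e 0
    · linear_combination -e 1
    · linear_combination e 0
  have l₂ : adLInt a b s₂ = (m₂ : ℂ)⁻¹ • (adLInt a b t₁ - adLInt a b t₂) := by
    rw [eq_inv_smul_iff₀ c₂]
    have e : ∀ i, (m₂ : ℂ) * s₂ i = t₁ i - t₂ i := fun i => by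
      exact_mod_cast congrFun e₂ i
    ext i j
    fin_cases i <;> fin_cases j <;> simp [adLInt, adL]
    · linear_combination (b : ℂ) * e 2
    · linear_combination -(b : ℂ) * e 1
    · linear_combination -(a : ℂ) * e 2
    · linear_combination (a : ℂ) * e 0
    · linear_combination -e 1
    · linear_combination e 0
  constructor
  · intro w hw n₁ n₂ g₁ g₂
    refine h.not_eigenvector w hw ((m₁ : ℂ)⁻¹ * (n₁ + n₂)) ((m₂ : ℂ)⁻¹ * (n₁ - n₂)) ?_ ?_
    · rw [l₁, smul_mulVec, add_mulVec, g₁, g₂, ← add_smul, smul_smul]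
    · rw [l₂, smul_mulVec, sub_mulVec, g₁, g₂, ← sub_smul, smul_smul]
  · intro Z g₁ g₂
    refine h.commutant Z ?_ ?_
    · rw [l₁, Matrix.smul_mul, Matrix.mul_smul, add_mul, mul_add, g₁, g₂]
    · rw [l₂, Matrix.smul_mul, Matrix.mul_smul, sub_mul, mul_sub, g₁, g₂]

theorem irreduciblePair_i_j {a b : ℤ} (ha : 0 < a) (hb : 0 < b) :
    IrreduciblePair a b ![1, 0, 0] ![0, 1, 0] := by
  have ha' : (a : ℂ) ≠ 0 := by exact_mod_cast ha.ne'
  have hb' : (b : ℂ) ≠ 0 := by exact_mod_cast hb.ne'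
  constructor
  · intro w hw m₁ m₂ g₁ g₂
    have p := fun i => congrFun g₁ i
    have q := fun i => congrFun g₂ i
    have p0 := p 0
    have p1 := p 1
    have p2 := p 2
    have q0 := q 0
    have q1 := q 1
    have q2 := q 2
    simp [adLInt, adL, Matrix.mulVec, dotProduct, Fin.sum_univ_three] at p0 p1 p2 q0 q1 q2
    apply hw
    ext i
    rcases p0 with h | h
    · subst h
      simp only [zero_mul, mul_eq_zero, ha', false_or] at p1 p2
      have w0 : w 0 = 0 := by
        rw [p1, mul_zero] at q2
        simpa using q2
      fin_cases i <;> assumption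
    · rw [h, mul_zero] at q0
      have w2 : w 2 = 0 := by simpa [hb'] using q0
      rw [w2, mul_zero] at p2
      fin_cases i <;> assumption
  · intro Z g₁ g₂
    have p := fun i j => congrFun (congrFun g₁ i) j
    have q := fun i j => congrFun (congrFun g₂ i) j
    have p01 := p 0 1
    have p02 := p 0 2
    have p10 := p 1 0
    have p20 := p 2 0
    have p12 := p 1 2
    have p22 := p 2 2
    have q01 := q 0 1
    have q02 := q 0 2
    simp [adLInt, adL, Matrix.mul_apply, Fin.sum_univ_three, ha', hb'] at p01 p02 p10 p20 p12 p22 q01 q02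
    refine ⟨Z 0 0, ?_⟩
    ext i j
    fin_cases i <;> fin_cases j <;> simp <;> grind

theorem irreduciblePair_i_k {a b : ℤ} (ha : 0 < a) (hb : 0 < b) :
    IrreduciblePair a b ![1, 0, 0] ![0, 0, 1] := by
  have ha' : (a : ℂ) ≠ 0 := by exact_mod_cast ha.ne'
  have hb' : (b : ℂ) ≠ 0 := by exact_mod_cast hb.ne'
  constructor
  · intro w hw m₁ m₂ g₁ g₂
    have p := fun i => congrFun g₁ i
    have q := fun i => congrFun g₂ i
    have p0 := p 0
    have p1 := p 1
    have p2 := p 2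
    have q0 := q 0
    have q1 := q 1
    have q2 := q 2
    simp [adLInt, adL, Matrix.mulVec, dotProduct, Fin.sum_univ_three] at p0 p1 p2 q0 q1 q2
    apply hw
    ext i
    rcases p0 with h | h
    · subst h
      simp only [zero_mul, mul_eq_zero, ha', false_or] at p1 p2
      have w0 : w 0 = 0 := by
        rw [p2, mul_zero] at q1
        simpa [ha'] using q1
      fin_cases i <;> assumption
    · rw [h, mul_zero] at q0
      have w1 : w 1 = 0 := by simpa [hb'] using q0
      have w2 : w 2 = 0 := by
        rw [w1, mul_zero] at p1
        simpa [ha'] using p1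
      fin_cases i <;> assumption
  · intro Z g₁ g₂
    have p := fun i j => congrFun (congrFun g₁ i) j
    have q := fun i j => congrFun (congrFun g₂ i) j
    have p01 := p 0 1
    have p02 := p 0 2
    have p10 := p 1 0
    have p20 := p 2 0
    have p12 := p 1 2
    have p22 := p 2 2
    have q02 := q 0 2
    have q01 := q 0 1
    simp [adLInt, adL, Matrix.mul_apply, Fin.sum_univ_three, ha', hb'] at p01 p02 p10 p20 p12 p22 q01 q02
    refine ⟨Z 0 0, ?_⟩
    ext i j
    fin_cases i <;> fin_cases j <;> simp <;> grind

/-- Pell's equation needs t² to be a positive nonsquare. If a = s², then bi ± j has square s²b² + b.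
Otherwise (b+1)i ± 2k has square a(b-1)², and b > 1 keeps it nonzero. -/
theorem exists_irreduciblePair {a b : ℤ} (ha : 0 < a) (hb : 1 < b) :
    ∃ t₁ t₂ : Fin 3 → ℤ, IrreduciblePair a b t₁ t₂ ∧
      (0 < pureSq a b t₁ ∧ ¬ IsSquare (pureSq a b t₁)) ∧
      (0 < pureSq a b t₂ ∧ ¬ IsSquare (pureSq a b t₂)) := by
  have hb0 : 0 < b := by omega
  by_cases hsq : IsSquare a
  · obtain ⟨s, hs⟩ := hsq
    have hs0 : 0 < |s| := abs_pos.mpr (by rintro rfl; omega)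
    have e₁ : pureSq a b ![b, 1, 0] = |s| * |s| * (b * b) + b := by
      rw [abs_mul_abs_self, hs]; simp only [pureSq, Matrix.cons_val]; ring
    have e₂ : pureSq a b ![b, -1, 0] = |s| * |s| * (b * b) + b := by
      rw [abs_mul_abs_self, hs]; simp only [pureSq, Matrix.cons_val]; ring
    have hpos : 0 < |s| * |s| * (b * b) + b := by positivity
    refine ⟨![b, 1, 0], ![b, -1, 0],
      (irreduciblePair_i_j ha hb0).of_linearCombination (m₁ := 2 * b) (m₂ := 2)
        (by omega) (by omega) (by ext i; fin_cases i <;> simp; ring)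
        (by ext i; fin_cases i <;> simp), ?_, ?_⟩
    · rw [e₁]; exact ⟨hpos, not_isSquare_sq_add hs0 hb0⟩
    · rw [e₂]; exact ⟨hpos, not_isSquare_sq_add hs0 hb0⟩
  · have e₁ : pureSq a b ![b + 1, 0, 2] = a * (b - 1) ^ 2 := by
      simp [pureSq]; ring
    have e₂ : pureSq a b ![b + 1, 0, -2] = a * (b - 1) ^ 2 := by
      simp [pureSq]; ring
    have hb1 : b - 1 ≠ 0 := by omega
    have hpos : 0 < a * (b - 1) ^ 2 := by positivity
    refine ⟨![b + 1, 0, 2], ![b + 1, 0, -2],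
      (irreduciblePair_i_k ha hb0).of_linearCombination (m₁ := 2 * (b + 1)) (m₂ := 4)
        (by omega) (by omega) (by ext i; fin_cases i <;> simp; ring)
        (by ext i; fin_cases i <;> simp), ?_, ?_⟩
    · rw [e₁]; exact ⟨hpos, not_isSquare_mul_sq hsq hb1⟩
    · rw [e₂]; exact ⟨hpos, not_isSquare_mul_sq hsq hb1⟩

/-- The quaternion `x + y t`, for a pure quaternion `t`. -/
def addSmulPure {R : Type*} [CommRing R] {a b : R} (t : Fin 3 → R) (x y : R) : ℍ[R, a, b] :=
  ⟨x, y * t 0, y * t 1, y * t 2⟩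

theorem nrd_addSmulPure {R : Type*} [CommRing R] {a b : R} (t : Fin 3 → R) (x y : R) :
    nrd (addSmulPure t x y : ℍ[R, a, b]) = x ^ 2 - pureSq a b t * y ^ 2 := by
  simp [nrd, addSmulPure, pureSq]; ring

/-- As t² > 0, positivity of both coefficients survives products, so no positive power of q becomes
scalar and all keep the direction t. -/
theorem exists_pow_eq_addSmulPure {a b : ℝ} {t : Fin 3 → ℝ} (ht : 0 < pureSq a b t)
    {q : ℍ[ℝ, a, b]} (hq : ∃ x y : ℝ, 0 < x ∧ 0 < y ∧ q = addSmulPure t x y) {n : ℕ}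
    (hn : 0 < n) : ∃ x y : ℝ, 0 < x ∧ 0 < y ∧ q ^ n = addSmulPure t x y := by
  obtain ⟨x, y, hx, hy, rfl⟩ := hq
  induction n, hn using Nat.le_induction with
  | base => exact ⟨x, y, hx, hy, by simp⟩
  | succ n hn ih =>
    obtain ⟨x', y', hx', hy', h⟩ := ih
    refine ⟨x' * x + pureSq a b t * (y' * y), x' * y + y' * x, by positivity, by positivity, ?_⟩
    rw [pow_succ, h]
    ext <;> simp [addSmulPure, pureSq] <;> ring

end PellElements

/-! ### Integral quaternions inside the Picard modular group -/

section Arithmetic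

noncomputable section

open NumberField

variable {K : Type*} [Field K] {ι : K →+* ℂ} {a b : ℤ}

theorem stabY_eq (ha : 0 < (a : ℝ)) (hb : 0 < (b : ℝ)) (z : ℂ) (hz : z ≠ 0) (haz : z = (a : ℝ)) :
    stabY ι z hz = (ProjGenLinGroup.map (n := Fin 3) (ι.comp (algebraMap (𝓞 K) K))).range ⊓
      (projAd (a : ℝ) (b : ℝ) ha hb).range := by
  subst haz
  have hframe : ProjGenLinGroup.mk (frame (a : ℝ) ha) ∈ PU12 := ⟨_, frame_mem_U12 _ ha, rfl⟩
  rw [range_projAd]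
  ext g
  constructor
  · rintro ⟨hg, h⟩
    rw [mul_inv_eq_iff_eq_mul, mk_Y_eq _ ha] at h
    exact ⟨hg.2, mem_conjPO12_of_stabilizes hframe hg.1 h⟩
  · rintro ⟨hg, h⟩
    refine ⟨⟨conjPO12_le_PU12 hframe h, hg⟩, ?_⟩
    rw [mul_inv_eq_iff_eq_mul, mk_Y_eq _ ha]
    exact conj_stabilizes h


theorem nrd_ofInt (q : QuatPoints ℤ a b) : nrd (ofInt q) = ((nrd q : ℤ) : ℝ) := by
  simp [nrd, ofInt]

theorem ofInt_mul (p q : QuatPoints ℤ a b) : ofInt (p * q) = ofInt p * ofInt q := by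
  ext <;> simp [ofInt]

theorem ofInt_star (q : QuatPoints ℤ a b) : ofInt (star q) = star (ofInt q) := by
  ext <;> simp [ofInt]

theorem adM_ofInt (q : QuatPoints ℤ a b) : adM (ofInt q) = (adM q).map (Int.cast : ℤ → ℝ) := by
  ext i j; fin_cases i <;> fin_cases j <;> simp [adM, ofInt]

/-- Integral quaternions congruent modulo `m` to a scalar of square `1`. -/
structure NearScalar (m : ℤ) (q : QuatPoints ℤ a b) : Prop where
  re : m ∣ q.re ^ 2 - 1
  imI : m ∣ q.imI
  imJ : m ∣ q.imJ
  imK : m ∣ q.imK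

theorem NearScalar.star {m : ℤ} {q : QuatPoints ℤ a b} (h : NearScalar m q) :
    NearScalar m (star q) :=
  ⟨by simpa using h.re, by simpa using h.imI, by simpa using h.imJ, by simpa using h.imK⟩

/-- Apart from the square of the real part on the diagonal, every monomial in `adM q` contains a
pure coordinate. -/
theorem NearScalar.exists_adM_eq {m : ℤ} {q : QuatPoints ℤ a b} (h : NearScalar m q) :
    ∃ C : Matrix (Fin 3) (Fin 3) ℤ, adM q = 1 + m • C := by
  obtain ⟨w, hw⟩ := h.re
  obtain ⟨x, hx⟩ := h.imI
  obtain ⟨y, hy⟩ := h.imJ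
  obtain ⟨z, hz⟩ := h.imK
  have hw' : q.re ^ 2 = 1 + m * w := by linarith
  refine ⟨!![w - a * m * x ^ 2 + b * m * y ^ 2 - a * b * m * z ^ 2,
      -2 * b * m * x * y + 2 * b * q.re * z, 2 * a * b * m * x * z - 2 * b * q.re * y;
    -2 * a * m * x * y - 2 * a * q.re * z,
      w + a * m * x ^ 2 - b * m * y ^ 2 - a * b * m * z ^ 2,
      2 * a * b * m * y * z + 2 * a * q.re * x;
    -2 * a * m * x * z - 2 * q.re * y, -2 * b * m * y * z + 2 * q.re * x,
      w + a * m * x ^ 2 + b * m * y ^ 2 + a * b * m * z ^ 2], ?_⟩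
  ext i j
  fin_cases i <;> fin_cases j <;> simp [adM, hw', hx, hy, hz] <;> ring

section Lattice

variable (a b) in
/-- `pureFrame` as a matrix of algebraic integers, given a square root `d` of `-b`. -/
def intFrame {R : Type*} [CommRing R] (d : R) : Matrix (Fin 3) (Fin 3) R :=
  !![d, 0, b; 0, b, 0; -(a * d), 0, a * b]

variable (a) in
/-- `pureFrameAdj` as a matrix of algebraic integers, given a square root `d` of `-b`. -/
def intFrameAdj {R : Type*} [CommRing R] (d : R) : Matrix (Fin 3) (Fin 3) R :=
  !![-(a * d), 0, d; 0, 2 * a, 0; a, 0, 1]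

theorem map_intFrame {R : Type*} [CommRing R] (f : R →+* ℂ) {d : R}
    (hd : f d = Complex.I * (√(b : ℝ) : ℝ)) (ha : 0 < (a : ℝ)) (hb : 0 < (b : ℝ)) :
    (intFrame a b d).map f = (pureFrame (a : ℝ) (b : ℝ) ha hb).1 := by
  rw [coe_pureFrame]
  ext i j; fin_cases i <;> fin_cases j <;> simp [intFrame, hd]

theorem map_intFrameAdj {R : Type*} [CommRing R] (f : R →+* ℂ) {d : R}
    (hd : f d = Complex.I * (√(b : ℝ) : ℝ)) :
    (intFrameAdj a d).map f = pureFrameAdj (a : ℝ) (b : ℝ) := by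
  ext i j; fin_cases i <;> fin_cases j <;> simp [intFrameAdj, pureFrameAdj, hd, map_ofNat f 2]

variable {R : Type*} [CommRing R] (f : R →+* ℂ) {d : R}

theorem pureFrame_inv (ha : 0 < (a : ℝ)) (hb : 0 < (b : ℝ)) :
    pureFrameAdj (a : ℝ) (b : ℝ) =
      ((2 * a * b : ℤ) : ℂ) • ((pureFrame (a : ℝ) (b : ℝ) ha hb)⁻¹).1 := by
  have h1 := pureFrame_mul_adj (a : ℝ) (b : ℝ) ha hb
  have h2 : ((pureFrame (a : ℝ) (b : ℝ) ha hb)⁻¹).1 * (pureFrame (a : ℝ) (b : ℝ) ha hb).1 = 1 :=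
    Units.inv_mul _
  calc _ = ((pureFrame (a : ℝ) (b : ℝ) ha hb)⁻¹).1 *
        ((pureFrame (a : ℝ) (b : ℝ) ha hb).1 * pureFrameAdj (a : ℝ) (b : ℝ)) := by
        rw [← Matrix.mul_assoc, h2, Matrix.one_mul]
    _ = _ := by rw [h1, Matrix.mul_smul, Matrix.mul_one]; push_cast; rfl

/-- The factor 2ab in front of C turns the inverse frame into the integral matrix `intFrameAdj`, so
conjugating by the frame creates no denominator. -/
theorem map_one_add_frame (ha : 0 < (a : ℝ)) (hb : 0 < (b : ℝ))
    (hd : f d = Complex.I * (√(b : ℝ) : ℝ)) {q : QuatPoints ℤ a b}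
    {C : Matrix (Fin 3) (Fin 3) ℤ} (hC : adM q = 1 + (2 * a * b) • C) :
    (1 + intFrame a b d * C.map (Int.cast : ℤ → R) * intFrameAdj a d).map f =
      (pureFrame (a : ℝ) (b : ℝ) ha hb).1 * (adM q).map (Int.cast : ℤ → ℂ) *
        ((pureFrame (a : ℝ) (b : ℝ) ha hb)⁻¹).1 := by
  have h3 : (pureFrame (a : ℝ) (b : ℝ) ha hb).1 * ((pureFrame (a : ℝ) (b : ℝ) ha hb)⁻¹).1 = 1 :=
    Units.mul_inv _
  have h4 : (adM q).map (Int.cast : ℤ → ℂ) =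
      1 + ((2 * a * b : ℤ) : ℂ) • C.map (Int.cast : ℤ → ℂ) := by
    rw [hC]
    ext i j
    simp only [Matrix.map_apply, Matrix.add_apply, Matrix.smul_apply, Matrix.one_apply, smul_eq_mul]
    split_ifs <;> simp
  have h5 : (C.map (Int.cast : ℤ → R)).map f = C.map (Int.cast : ℤ → ℂ) := by
    ext i j; simp
  have h6 : (1 + intFrame a b d * C.map (Int.cast : ℤ → R) * intFrameAdj a d).map f =
      1 + (intFrame a b d).map f * (C.map (Int.cast : ℤ → R)).map f * (intFrameAdj a d).map f := by
    have := (f.mapMatrix (m := Fin 3)).map_add 1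
      (intFrame a b d * C.map (Int.cast : ℤ → R) * intFrameAdj a d)
    rw [map_one, map_mul, map_mul] at this
    exact this
  rw [h6, h5, map_intFrame f hd ha hb, map_intFrameAdj f hd, pureFrame_inv ha hb, h4]
  rw [mul_add, add_mul, Matrix.mul_one, h3, Matrix.mul_smul, Matrix.mul_smul, Matrix.smul_mul]

theorem projAd_mem_range_map (ha : 0 < (a : ℝ)) (hb : 0 < (b : ℝ)) (hf : Function.Injective f)
    (hd : f d = Complex.I * (√(b : ℝ) : ℝ)) {q : QuatPoints ℤ a b} (hq : NearScalar (2 * a * b) q)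
    (hn : nrd q = 1) {u : (QuatPoints ℝ a b)ˣ} (hu : (u : QuatPoints ℝ a b) = ofInt q) :
    projAd (a : ℝ) (b : ℝ) ha hb u ∈ (ProjGenLinGroup.map (n := Fin 3) f).range := by
  obtain ⟨C, hC⟩ := hq.exists_adM_eq
  -- The conjugate quaternion supplies the inverse matrix, which must also be integral.
  obtain ⟨C', hC'⟩ := hq.star.exists_adM_eq
  have m1 := map_one_add_frame f ha hb hd hC
  have m2 := map_one_add_frame f ha hb hd hC'
  set X := 1 + intFrame a b d * C.map (Int.cast : ℤ → R) * intFrameAdj a d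
  set X' := 1 + intFrame a b d * C'.map (Int.cast : ℤ → R) * intFrameAdj a d
  have h3 : (pureFrame (a : ℝ) (b : ℝ) ha hb).1 * ((pureFrame (a : ℝ) (b : ℝ) ha hb)⁻¹).1 = 1 :=
    Units.mul_inv _
  have h2 : ((pureFrame (a : ℝ) (b : ℝ) ha hb)⁻¹).1 * (pureFrame (a : ℝ) (b : ℝ) ha hb).1 = 1 :=
    Units.inv_mul _
  have h4 : (adM q).map (Int.cast : ℤ → ℂ) * (adM (star q)).map (Int.cast : ℤ → ℂ) = 1 := by
    have := (Int.castRingHom ℂ).mapMatrix.map_mul (adM q) (adM (star q))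
    rw [adM_mul_adM_star, hn, one_pow, one_smul, map_one] at this
    exact this.symm
  have h5 : X * X' = 1 := by
    apply Matrix.map_injective hf
    change (X * X').map f = (1 : Matrix (Fin 3) (Fin 3) R).map f
    rw [Matrix.map_mul, m1, m2, Matrix.map_one _ f.map_zero f.map_one]
    calc _ = (pureFrame (a : ℝ) (b : ℝ) ha hb).1 * ((adM q).map (Int.cast : ℤ → ℂ) *
          (((pureFrame (a : ℝ) (b : ℝ) ha hb)⁻¹).1 * (pureFrame (a : ℝ) (b : ℝ) ha hb).1) *
          (adM (star q)).map (Int.cast : ℤ → ℂ)) * ((pureFrame (a : ℝ) (b : ℝ) ha hb)⁻¹).1 := by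
          simp only [Matrix.mul_assoc]
      _ = 1 := by rw [h2, Matrix.mul_one, h4, Matrix.mul_one, h3]
  have h6 : X' * X = 1 := mul_eq_one_comm.mp h5
  refine ⟨ProjGenLinGroup.mk ⟨X, X', h5, h6⟩, ?_⟩
  rw [ProjGenLinGroup.map_mk, projAd_apply]
  congr 1
  apply Units.ext
  change X.map f = (pureFrame (a : ℝ) (b : ℝ) ha hb).1 * (adM (u : QuatPoints ℝ a b)).map _ * _
  rw [m1, hu, adM_ofInt]
  congr 2

end Lattice

end

end Arithmetic

/-! ### Nonelementarity and uniqueness of the real structure -/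

section Irreducibility

noncomputable section

open NumberField

variable {a b : ℤ}

/-- Solving Pell's equation for t² m² instead of t² gives q = x + |m| y t with x² ≡ 1 modulo m. The
absolute value keeps the coefficient of t positive. -/
theorem exists_nearScalar_pell (m : ℤ) (hm : m ≠ 0) {t : Fin 3 → ℤ} (ht : 0 < pureSq a b t)
    (hsq : ¬ IsSquare (pureSq a b t)) :
    ∃ (q : QuatPoints ℤ a b) (u : (QuatPoints ℝ a b)ˣ), (u : QuatPoints ℝ a b) = ofInt q ∧
      NearScalar m q ∧ nrd q = 1 ∧ ∃ x y : ℝ, 0 < x ∧ 0 < y ∧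
        (u : QuatPoints ℝ a b) = addSmulPure (fun i => (t i : ℝ)) x y := by
  obtain ⟨s, hx, hy⟩ := Pell.Solution₁.exists_pos_of_not_isSquare
    (d := pureSq a b t * m ^ 2) (by positivity) (not_isSquare_mul_sq hsq hm)
  have hprop := s.prop
  have hm2 : 0 < |m| := abs_pos.mpr hm
  let q : QuatPoints ℤ a b := addSmulPure t s.x (|m| * s.y)
  have hn : nrd q = 1 := by
    have : nrd q = s.x ^ 2 - pureSq a b t * (|m| * s.y) ^ 2 := nrd_addSmulPure t _ _
    rw [this, mul_pow, sq_abs]; linarith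
  have hunit : IsUnit (ofInt q) := isUnit_of_nrd_ne_zero (by rw [nrd_ofInt, hn]; simp)
  refine ⟨q, hunit.unit, rfl, ⟨?_, ?_, ?_, ?_⟩, hn, s.x, |m| * s.y, ?_, ?_, ?_⟩
  · exact ⟨pureSq a b t * m * s.y ^ 2, by change s.x ^ 2 - 1 = _; linarith⟩
  · exact (self_dvd_abs m).mul_right _ |>.mul_right _
  · exact (self_dvd_abs m).mul_right _ |>.mul_right _
  · exact (self_dvd_abs m).mul_right _ |>.mul_right _
  · exact_mod_cast (by linarith : 0 < s.x)
  · have : 0 < |m| * s.y := by positivity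
    exact_mod_cast this
  · change ofInt q = _
    ext <;> simp [ofInt, q, addSmulPure]

/-- The complexified adjoint matrix of a real quaternion. -/
def adC (u : QuatPoints ℝ a b) : Matrix (Fin 3) (Fin 3) ℂ := (adM u).map Complex.ofRealHom

theorem adC_mul (p q : QuatPoints ℝ a b) : adC (p * q) = adC p * adC q := by
  rw [adC, adM_mul, Matrix.map_mul]; rfl

theorem adC_mul_star {q : QuatPoints ℝ a b} (hq : nrd q = 1) : adC q * adC (star q) = 1 := by
  rw [adC, adC, ← Matrix.map_mul, adM_mul_adM_star, hq, one_pow, one_smul,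
    Matrix.map_one _ (map_zero _) (map_one _)]

theorem adC_star_mul {q : QuatPoints ℝ a b} (hq : nrd q = 1) : adC (star q) * adC q = 1 :=
  mul_eq_one_comm.mp (adC_mul_star hq)

theorem adC_sub {t : Fin 3 → ℤ} {x y : ℝ} {q : QuatPoints ℝ a b}
    (hq : q = addSmulPure (fun i => (t i : ℝ)) x y) :
    adC q - adC (star q) = (4 * x * y : ℂ) • adLInt a b t := by
  have h1 := adM_sub_adM_star q
  have h2 : adC q - adC (star q) = (adM q - adM (star q)).map Complex.ofRealHom := by
    ext i j; simp [adC]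
  rw [h2, h1, hq]
  ext i j
  fin_cases i <;> fin_cases j <;> simp [adL, adLInt, addSmulPure] <;> ring

/-- An eigenvector of a matrix is one of its inverse, and the difference of the two matrices is the
nonzero multiple 4xy of `adLInt a b t`. -/
theorem adLInt_mulVec_of_fixed {t : Fin 3 → ℤ} {x y : ℝ} (hx : 0 < x) (hy : 0 < y)
    {q : QuatPoints ℝ a b} (hq : q = addSmulPure (fun i => (t i : ℝ)) x y) (hn : nrd q = 1)
    {w : Fin 3 → ℂ} {c : ℂ} (h : adC q *ᵥ w = c • w) :
    ∃ m : ℂ, adLInt a b t *ᵥ w = m • w := by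
  have h1 : adC (star q) *ᵥ w = c⁻¹ • w := by
    have h2 : w = c • adC (star q) *ᵥ w := by
      rw [← Matrix.mulVec_smul, ← h, Matrix.mulVec_mulVec, adC_star_mul hn, Matrix.one_mulVec]
    by_cases hc : c = 0
    · have hw : w = 0 := by rw [h2, hc, zero_smul]
      rw [hw]; simp
    · exact (eq_inv_smul_iff₀ hc).mpr h2.symm
  have hxy : (4 * x * y : ℂ) ≠ 0 := by
    have : (4 * x * y : ℝ) ≠ 0 := by positivity
    exact_mod_cast this
  refine ⟨(4 * x * y : ℂ)⁻¹ * (c - c⁻¹), ?_⟩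
  rw [mul_smul, eq_inv_smul_iff₀ hxy, ← Matrix.smul_mulVec, ← adC_sub hq, Matrix.sub_mulVec, h, h1,
    sub_smul]

theorem adLInt_commute {t : Fin 3 → ℤ} {x y : ℝ} (hx : 0 < x) (hy : 0 < y)
    {q : QuatPoints ℝ a b} (hq : q = addSmulPure (fun i => (t i : ℝ)) x y) (hn : nrd q = 1)
    {Z : Matrix (Fin 3) (Fin 3) ℂ} (h : adC q * Z = Z * adC q) :
    adLInt a b t * Z = Z * adLInt a b t := by
  have h1 : adC (star q) * Z = Z * adC (star q) := by
    calc adC (star q) * Z = adC (star q) * (Z * adC q) * adC (star q) := by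
          rw [Matrix.mul_assoc, Matrix.mul_assoc, adC_mul_star hn, Matrix.mul_one]
      _ = (adC (star q) * adC q) * Z * adC (star q) := by rw [← h]; simp only [Matrix.mul_assoc]
      _ = _ := by rw [adC_star_mul hn, Matrix.one_mul]
  have hxy : (4 * x * y : ℂ) ≠ 0 := by
    have : (4 * x * y : ℝ) ≠ 0 := by positivity
    exact_mod_cast this
  have h2 : (4 * x * y : ℂ) • (adLInt a b t * Z) = (4 * x * y : ℂ) • (Z * adLInt a b t) := by
    rw [← Matrix.smul_mul, ← Matrix.mul_smul, ← adC_sub hq, sub_mul, mul_sub, h, h1]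
  exact smul_right_injective _ hxy h2

theorem exists_pow_smul_eq_of_finite {G X : Type*} [Group G] [MulAction G X] {x : X}
    (h : (MulAction.orbit G x).Finite) (g : G) : ∃ n : ℕ, 0 < n ∧ g ^ n • x = x := by
  have : Finite (MulAction.orbit G x) := h
  obtain ⟨m, n, hmn, he⟩ := Finite.exists_ne_map_eq_of_infinite
    (fun n : ℕ => (⟨g ^ n • x, MulAction.mem_orbit x _⟩ : MulAction.orbit G x))
  have he' : g ^ m • x = g ^ n • x := congrArg Subtype.val he
  rcases lt_or_gt_of_ne hmn with h | h
  · refine ⟨n - m, by omega, smul_left_cancel (g ^ m) ?_⟩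
    rw [smul_smul, ← pow_add, Nat.add_sub_cancel' h.le, he']
  · refine ⟨m - n, by omega, smul_left_cancel (g ^ n) ?_⟩
    rw [smul_smul, ← pow_add, Nat.add_sub_cancel' h.le, he']

theorem adC_mulVec_of_projAd_smul (ha : 0 < (a : ℝ)) (hb : 0 < (b : ℝ)) (u : (QuatPoints ℝ a b)ˣ)
    {z : Fin 3 → ℂ} (hz : z ≠ 0)
    (h : projAd (a : ℝ) (b : ℝ) ha hb u • (Projectivization.mk ℂ z hz : ℙ ℂ (Fin 3 → ℂ)) =
      Projectivization.mk ℂ z hz) :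
    ∃ c : ℂ, adC (u : QuatPoints ℝ a b) *ᵥ (((pureFrame (a : ℝ) (b : ℝ) ha hb)⁻¹).1 *ᵥ z) =
      c • (((pureFrame (a : ℝ) (b : ℝ) ha hb)⁻¹).1 *ᵥ z) := by
  rw [projAd_apply, Projectivization.PGL.mk_smul_mk, Projectivization.mk_eq_mk_iff'] at h
  obtain ⟨c, hc⟩ := h
  have hc' : ((pureFrame (a : ℝ) (b : ℝ) ha hb).1 * adC (u : QuatPoints ℝ a b) *
      ((pureFrame (a : ℝ) (b : ℝ) ha hb)⁻¹).1) *ᵥ z = c • z := hc.symm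
  have h2 : ((pureFrame (a : ℝ) (b : ℝ) ha hb)⁻¹).1 * (pureFrame (a : ℝ) (b : ℝ) ha hb).1 = 1 :=
    Units.inv_mul _
  refine ⟨c, ?_⟩
  rw [← Matrix.mulVec_smul, ← hc', Matrix.mulVec_mulVec, Matrix.mulVec_mulVec, Matrix.mul_assoc,
    ← Matrix.mul_assoc, h2, Matrix.one_mul]

/-- `Γ` contains the image of a congruence subgroup of the integral quaternions of norm `1`. -/
def ContainsNearScalar (ha : 0 < (a : ℝ)) (hb : 0 < (b : ℝ)) (Γ : Subgroup PGL(3, ℂ)) : Prop :=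
  ∃ m : ℤ, m ≠ 0 ∧ ∀ (q : QuatPoints ℤ a b) (u : (QuatPoints ℝ a b)ˣ),
    NearScalar m q → nrd q = 1 → (u : QuatPoints ℝ a b) = ofInt q →
      projAd (a : ℝ) (b : ℝ) ha hb u ∈ Γ

variable {ha : 0 < (a : ℝ)} {hb : 0 < (b : ℝ)} {Γ : Subgroup PGL(3, ℂ)}

theorem nrd_coe_pow {u : (QuatPoints ℝ a b)ˣ} (hu : nrd (u : QuatPoints ℝ a b) = 1) (n : ℕ) :
    nrd ((u ^ n : (QuatPoints ℝ a b)ˣ) : QuatPoints ℝ a b) = 1 := by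
  induction n with
  | zero => simp
  | succ n ih => rw [pow_succ, Units.val_mul, nrd_mul, ih, hu, mul_one]

theorem pureSq_intCast (t : Fin 3 → ℤ) :
    pureSq (a : ℝ) b (fun i => (t i : ℝ)) = ((pureSq a b t : ℤ) : ℝ) := by
  simp [pureSq]

/-- A point with finite orbit is fixed by a positive power of each Pell element. Such powers keep
their direction t, so the point would be a common eigenvector of an irreducible pair. -/
theorem isNonelementary_of_containsNearScalar (hb1 : 1 < b) (hΓ : ContainsNearScalar ha hb Γ) :
    IsNonelementary Γ := by
  intro z hz _
  by_contra hfin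
  rw [Set.not_infinite] at hfin
  obtain ⟨t₁, t₂, hpair, ⟨p₁, s₁⟩, p₂, s₂⟩ := exists_irreduciblePair (by exact_mod_cast ha) hb1
  obtain ⟨m, hm, hΓ⟩ := hΓ
  have key : ∀ t : Fin 3 → ℤ, 0 < pureSq a b t → ¬ IsSquare (pureSq a b t) →
      ∃ c : ℂ, adLInt a b t *ᵥ (((pureFrame (a : ℝ) (b : ℝ) ha hb)⁻¹).1 *ᵥ z) =
        c • (((pureFrame (a : ℝ) (b : ℝ) ha hb)⁻¹).1 *ᵥ z) := by
    intro t ht hsq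
    obtain ⟨q, u, hu, hq, hn, hxy⟩ := exists_nearScalar_pell m hm ht hsq
    have hmem := hΓ q u hq hn hu
    obtain ⟨n, hn0, hfix⟩ := exists_pow_smul_eq_of_finite hfin ⟨_, hmem⟩
    have hfix' : projAd (a : ℝ) (b : ℝ) ha hb (u ^ n) •
        (Projectivization.mk ℂ z hz : ℙ ℂ (Fin 3 → ℂ)) = Projectivization.mk ℂ z hz := by
      rw [map_pow]; exact hfix
    obtain ⟨c, hc⟩ := adC_mulVec_of_projAd_smul ha hb _ hz hfix'
    obtain ⟨x, y, hx, hy, hpow⟩ := exists_pow_eq_addSmulPure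
      (t := fun i => (t i : ℝ)) (by rw [pureSq_intCast]; exact_mod_cast ht) hxy hn0
    have hnu : nrd (u : QuatPoints ℝ a b) = 1 := by rw [hu, nrd_ofInt, hn]; simp
    exact adLInt_mulVec_of_fixed hx hy
      (show ((u ^ n : (QuatPoints ℝ a b)ˣ) : QuatPoints ℝ a b) = _ by
        rw [Units.val_pow_eq_pow_val]; exact hpow) (nrd_coe_pow hnu n) hc
  obtain ⟨c₁, h₁⟩ := key t₁ p₁ s₁
  obtain ⟨c₂, h₂⟩ := key t₂ p₂ s₂
  refine hpair.not_eigenvector _ ?_ c₁ c₂ h₁ h₂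
  intro h0
  apply hz
  have h3 : (pureFrame (a : ℝ) (b : ℝ) ha hb).1 * ((pureFrame (a : ℝ) (b : ℝ) ha hb)⁻¹).1 = 1 :=
    Units.mul_inv _
  rw [← Matrix.one_mulVec z, ← h3, ← Matrix.mulVec_mulVec, h0, Matrix.mulVec_zero]

theorem eq_one_of_commute (hb1 : 1 < b) (hΓ : ContainsNearScalar ha hb Γ) {g : PGL(3, ℂ)}
    (hg : ∀ γ ∈ Γ, γ * g = g * γ) : g = 1 := by
  obtain ⟨t₁, t₂, hpair, ⟨p₁, s₁⟩, p₂, s₂⟩ := exists_irreduciblePair (by exact_mod_cast ha) hb1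
  obtain ⟨m, hm, hΓ⟩ := hΓ
  set p := ProjGenLinGroup.mk (pureFrame (a : ℝ) (b : ℝ) ha hb) with hp
  obtain ⟨Z, hZ⟩ := ProjGenLinGroup.mk_surjective (p⁻¹ * g * p)
  have key : ∀ t : Fin 3 → ℤ, 0 < pureSq a b t → ¬ IsSquare (pureSq a b t) →
      adLInt a b t * Z.1 = Z.1 * adLInt a b t := by
    intro t ht hsq
    obtain ⟨q, u, hu, hq, hn, hxy⟩ := exists_nearScalar_pell m hm ht hsq
    have hcomm := hg _ (hΓ q u hq hn hu)
    have hnu : nrd (u : QuatPoints ℝ a b) = 1 := by rw [hu, nrd_ofInt, hn]; simp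
    set A := GeneralLinearGroup.map Complex.ofRealHom (adGL u) with hA
    have h1 : projAd (a : ℝ) (b : ℝ) ha hb u = p * ProjGenLinGroup.mk A * p⁻¹ := by
      simp [projAd, hp, hA]
    have h2 : ProjGenLinGroup.mk (Z * A) = ProjGenLinGroup.mk (A * Z) := by
      rw [map_mul, map_mul, hZ]
      rw [h1] at hcomm
      calc p⁻¹ * g * p * ProjGenLinGroup.mk A = p⁻¹ * (g * (p * ProjGenLinGroup.mk A * p⁻¹)) * p := by
            group
        _ = _ := by rw [← hcomm]; group
    obtain ⟨c, hc, h3⟩ := exists_smul_of_mk_eq_mk h2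
    have h3 : adC (u : QuatPoints ℝ a b) * Z.1 = c • (Z.1 * adC (u : QuatPoints ℝ a b)) := h3
    have hZdet : Z.1.det ≠ 0 := (Z.isUnit.map Matrix.detMonoidHom).ne_zero
    have hAdet : (adC (u : QuatPoints ℝ a b)).det ≠ 0 := by
      intro h0
      have := congrArg Matrix.det (adC_mul_star hnu)
      rw [det_mul, h0, zero_mul, det_one] at this
      exact zero_ne_one this
    -- Commuting in PGL₃ is commuting up to a scalar c. Determinants give c³ = 1, so the cube of u,
    -- which has the same direction t, commutes exactly.
    have hc3 : c ^ 3 = 1 := by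
      have := congrArg Matrix.det h3
      rw [det_smul, det_mul, det_mul, Fintype.card_fin] at this
      apply mul_right_cancel₀ (mul_ne_zero hZdet hAdet)
      linear_combination -this
    have h4 : adC ((u ^ 3 : (QuatPoints ℝ a b)ˣ) : QuatPoints ℝ a b) * Z.1 =
        Z.1 * adC ((u ^ 3 : (QuatPoints ℝ a b)ˣ) : QuatPoints ℝ a b) := by
      rw [pow_succ, pow_two, Units.val_mul, Units.val_mul, adC_mul, adC_mul]
      set B := adC (u : QuatPoints ℝ a b)
      calc B * B * B * Z.1 = B * (B * (B * Z.1)) := by simp only [Matrix.mul_assoc]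
        _ = B * (B * (c • (Z.1 * B))) := by rw [h3]
        _ = c • (B * (B * Z.1 * B)) := by
            simp only [Matrix.mul_smul, Matrix.mul_assoc]
        _ = c • (B * (c • (Z.1 * B) * B)) := by rw [h3]
        _ = (c * c) • (B * Z.1 * (B * B)) := by
            simp only [Matrix.mul_smul, Matrix.smul_mul, Matrix.mul_assoc, smul_smul]
        _ = (c * c) • (c • (Z.1 * B) * (B * B)) := by rw [h3]
        _ = (c * c * c) • (Z.1 * (B * B * B)) := by
            simp only [Matrix.smul_mul, Matrix.mul_assoc, smul_smul]
        _ = _ := by rw [show c * c * c = 1 by rw [← hc3]; ring, one_smul]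
    obtain ⟨x, y, hx, hy, hpow⟩ := exists_pow_eq_addSmulPure
      (t := fun i => (t i : ℝ)) (by rw [pureSq_intCast]; exact_mod_cast ht) hxy (n := 3) (by omega)
    exact adLInt_commute hx hy
      (show ((u ^ 3 : (QuatPoints ℝ a b)ˣ) : QuatPoints ℝ a b) = _ by
        rw [Units.val_pow_eq_pow_val]; exact hpow) (nrd_coe_pow hnu 3) h4
  obtain ⟨c, hc⟩ := hpair.commutant Z.1 (key t₁ p₁ s₁) (key t₂ p₂ s₂)
  have hc0 : c ≠ 0 := by
    rintro rfl
    exact Z.ne_zero (by rw [hc, zero_smul])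
  have h1 : ProjGenLinGroup.mk (1 : GL (Fin 3) ℂ) = ProjGenLinGroup.mk Z :=
    mk_eq_mk_of_smul hc0 hc
  rw [← h1, ProjGenLinGroup.mk_one] at hZ
  calc g = p * (p⁻¹ * g * p) * p⁻¹ := by group
    _ = 1 := by rw [← hZ]; group

/-- Let σ = c (conj c)⁻¹ be a real structure preserved by H. Both σ and [Y] intertwine the
stabiliser with its complex conjugate, so σ[Y]⁻¹ commutes with the stabiliser and is trivial by
`eq_one_of_commute`. Thus H fixes [Y]. -/
theorem le_stabY_of_le {K : Type*} [Field K] {ι : K →+* ℂ} (hb1 : 1 < b) (z : ℂ) (hz : z ≠ 0)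
    (hΓ : ContainsNearScalar ha hb (stabY ι z hz)) {H : Subgroup PGL(3, ℂ)}
    (hH : H ≤ picard ι) (hH' : IsRFuchsian H) (hle : stabY ι z hz ≤ H) : H ≤ stabY ι z hz := by
  obtain ⟨-, c, hc, hHc⟩ := hH'
  have hζ : c * (conjPGL c)⁻¹ * (ProjGenLinGroup.mk (Y z hz))⁻¹ = 1 := by
    refine eq_one_of_commute hb1 hΓ fun γ hγ => ?_
    have h1 := conj_stabilizes (hHc (hle hγ))
    have h2 := hγ.2
    rw [mul_inv_eq_iff_eq_mul] at h2
    have h3 : (ProjGenLinGroup.mk (Y z hz))⁻¹ * γ =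
        conjPGL γ * (ProjGenLinGroup.mk (Y z hz))⁻¹ := by
      rw [inv_mul_eq_iff_eq_mul, ← mul_assoc, eq_mul_inv_iff_mul_eq]
      exact h2
    calc γ * (c * (conjPGL c)⁻¹ * (ProjGenLinGroup.mk (Y z hz))⁻¹)
        = γ * (c * (conjPGL c)⁻¹) * (ProjGenLinGroup.mk (Y z hz))⁻¹ := (mul_assoc _ _ _).symm
      _ = c * (conjPGL c)⁻¹ * ((ProjGenLinGroup.mk (Y z hz))⁻¹ * γ) := by rw [h1, h3, mul_assoc]
      _ = _ := (mul_assoc _ _ _).symm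
  intro h hh
  refine ⟨hH hh, ?_⟩
  rw [mul_inv_eq_one] at hζ
  rw [← hζ, mul_inv_eq_iff_eq_mul]
  exact conj_stabilizes (hHc hh)

end

end Irreducibility

/-! ### Bounding the denominators of arithmetic elements -/

section Commensurability

noncomputable section

open NumberField

theorem relIndex_ne_zero_of_finite {G α : Type*} [Group G] [Finite α] {H L : Subgroup G}
    (f : H → α) (hf : ∀ x y : H, f x = f y → ((x : G)⁻¹ * y) ∈ L) : L.relIndex H ≠ 0 := by
  have : Finite (H ⧸ L.subgroupOf H) := by
    refine Finite.of_injective (fun x : H ⧸ L.subgroupOf H => f x.out) fun x y h => ?_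
    rw [← QuotientGroup.out_eq' x, ← QuotientGroup.out_eq' y]
    exact QuotientGroup.eq.mpr (hf _ _ h)
  exact Subgroup.index_ne_zero_of_finite

/-- A nonzero real vector whose coordinates have integral products, up to a common factor, is
proportional to an integral vector with a controlled factor. -/
theorem exists_smul_int_of_mul_int {n : Type*} [Fintype n] {c : n → ℝ} (hc : c ≠ 0) {M : ℤ}
    (hM : M ≠ 0) (h : ∀ i j, ∃ k : ℤ, (M : ℝ) * (c i * c j) = k) :
    ∃ (u : n → ℤ) (s : ℝ) (e : ℤ), s ≠ 0 ∧ (∀ i, c i = s * u i) ∧ (M : ℝ) * s ^ 2 = e := by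
  obtain ⟨i, hi⟩ := Function.ne_iff.mp hc
  have hi : c i ≠ 0 := hi
  have hM' : (M : ℝ) ≠ 0 := by exact_mod_cast hM
  choose k hk using h
  -- Let g be the gcd of row i of the integers k. Then u is that row divided by g, and its Bézout
  -- relation expresses M s² as an integral combination of the k j l.
  obtain ⟨g, hg⟩ := (IsPrincipalIdealRing.principal (Ideal.span (Set.range (k i)))).principal
  have hdvd : ∀ j, ∃ l, k i j = g * l := by
    intro j
    have h1 : k i j ∈ Ideal.span (Set.range (k i)) := Ideal.subset_span ⟨j, rfl⟩
    rw [hg] at h1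
    exact Ideal.mem_span_singleton.mp h1
  choose u hu using hdvd
  have hgmem : g ∈ Ideal.span (Set.range (k i)) := by
    rw [hg]; exact Submodule.mem_span_singleton_self g
  obtain ⟨α, hα⟩ := Ideal.mem_span_range_iff_exists_fun.mp hgmem
  have hg0 : g ≠ 0 := by
    rintro rfl
    have h1 := hk i i
    rw [hu i, zero_mul, Int.cast_zero] at h1
    exact mul_ne_zero hM' (mul_ne_zero hi hi) h1
  have hbez : ∑ j, α j * u j = 1 := by
    apply mul_left_cancel₀ hg0
    rw [mul_one, Finset.mul_sum]
    conv_rhs => rw [← hα]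
    exact Finset.sum_congr rfl fun j _ => by rw [hu j]; ring
  have hcu : ∀ j, c j = (g / (M * c i)) * u j := by
    intro j
    have h1 := hk i j
    rw [hu j] at h1
    push_cast at h1
    field_simp
    linear_combination h1
  refine ⟨u, g / (M * c i), ∑ j, ∑ l, α j * α l * k j l, ?_, hcu, ?_⟩
  · have : (g : ℝ) ≠ 0 := by exact_mod_cast hg0
    exact div_ne_zero this (mul_ne_zero hM' hi)
  · push_cast
    simp_rw [← hk]
    set s : ℝ := g / (M * c i) with hs
    have hbez' : ∑ j, (α j : ℝ) * u j = 1 := by exact_mod_cast hbez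
    calc (M : ℝ) * s ^ 2 = M * s ^ 2 * ((∑ j, (α j : ℝ) * u j) * ∑ l, (α l : ℝ) * u l) := by
          rw [hbez']; ring
      _ = _ := by
        rw [Finset.sum_mul_sum, Finset.mul_sum]
        refine Finset.sum_congr rfl fun j _ => ?_
        rw [Finset.mul_sum]
        refine Finset.sum_congr rfl fun l _ => ?_
        rw [hcu j, hcu l]
        ring

variable {a b : ℤ}

/-- If the products of entries of `adM q` and of its inverse have a common denominator, so do the
products of coordinates of `q`. -/
theorem coord_mul_int {q : QuatPoints ℝ a b}
    (hq : nrd q = 1 ∨ nrd q = -1) {N : ℤ}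
    (h : ∀ i j k l, ∃ m : ℤ, (N : ℝ) * (adM q i j * adM (star q) k l) = m) (i j : Fin 4) :
    ∃ m : ℤ, ((4 * a * b * (N * (a * b)) ^ 2 : ℤ) : ℝ) *
      (![q.re, q.imI, q.imJ, q.imK] i * ![q.re, q.imI, q.imJ, q.imK] j) = m := by
  let S : Subring ℝ := (Int.castRingHom ℝ).range
  have hS : ∀ x : ℝ, x ∈ S ↔ ∃ m : ℤ, x = m := fun x =>
    ⟨fun ⟨m, hm⟩ => ⟨m, hm.symm⟩, fun ⟨m, hm⟩ => ⟨m, hm.symm⟩⟩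
  have hint : ∀ m : ℤ, (m : ℝ) ∈ S := fun m => ⟨m, rfl⟩
  -- The matrix of `star q` is the adjoint of that of q for `pureForm`, hence its transpose up to
  -- ratios of a, b and -ab.
  have htr : ∀ k l, ∃ c : ℤ, (a * b : ℝ) * adM q k l = c * adM (star q) l k := by
    intro k l
    fin_cases k <;> fin_cases l
    · exact ⟨a * b, by simp [adM]⟩
    · exact ⟨b * b, by simp [adM]; ring⟩
    · exact ⟨-(a * b * b), by simp [adM]; ring⟩
    · exact ⟨a * a, by simp [adM]; ring⟩
    · exact ⟨a * b, by simp [adM]⟩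
    · exact ⟨-(a * a * b), by simp [adM]; ring⟩
    · exact ⟨-a, by simp [adM]; ring⟩
    · exact ⟨-b, by simp [adM]; ring⟩
    · exact ⟨a * b, by simp [adM]⟩
  set L : ℝ := N * (a * b) with hL
  have h2 : ∀ i j k l, L * (adM q i j * adM q k l) ∈ S := by
    intro i j k l
    obtain ⟨c, hc⟩ := htr k l
    obtain ⟨m, hm⟩ := h i j l k
    have : L * (adM q i j * adM q k l) = c * m := by
      rw [← hm, hL]; linear_combination (N * adM q i j) * hc
    rw [this]
    exact S.mul_mem (hint _) (hint _)
  have hdet := det_adM q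
  have h1 : ∀ i j, L ^ 2 * adM q i j ∈ S := by
    intro i j
    -- The determinant is ±1. Multiplying by it turns a single entry into a sum of products of four
    -- entries, and L clears each pair.
    have h3 : L ^ 2 * adM q i j * (adM q).det ∈ S := by
      rw [det_fin_three]
      have t : ∀ r s t, (L * (adM q i j * adM q 0 r)) * (L * (adM q 1 s * adM q 2 t)) ∈ S :=
        fun r s t => S.mul_mem (h2 _ _ _ _) (h2 _ _ _ _)
      have := S.sub_mem (S.add_mem (S.add_mem (S.sub_mem (S.sub_mem (t 0 1 2) (t 0 2 1))
        (t 1 0 2)) (t 1 2 0)) (t 2 0 1)) (t 2 1 0)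
      convert this using 1
      ring
    rcases hq with e | e
    · rw [hdet, e] at h3
      simpa using h3
    · rw [hdet, e] at h3
      have := S.neg_mem h3
      convert this using 1
      ring
  have hL2 : L ^ 2 ∈ S := by
    rw [hL]; exact S.pow_mem (S.mul_mem (hint _) (S.mul_mem (hint _) (hint _))) 2
  have hε : L ^ 2 * nrd q ∈ S := by
    rcases hq with e | e <;> rw [e]
    · simpa using hL2
    · simpa using S.neg_mem hL2
  have hN : nrd q = q.re ^ 2 - a * q.imI ^ 2 - b * q.imJ ^ 2 + a * b * q.imK ^ 2 := rfl
  have i' : ∀ {x : ℝ} (m : ℤ), x ∈ S → (m : ℝ) * x ∈ S := fun m hx => S.mul_mem (hint m) hx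
  -- The nine entries and the reduced norm span the ten quadratic monomials in the coordinates, with
  -- denominators dividing 4ab.
  have ww := i' (a * b) (S.add_mem (S.add_mem (S.add_mem (h1 0 0) (h1 1 1)) (h1 2 2)) hε)
  have xx := i' (-b) (S.add_mem (S.sub_mem (S.sub_mem (h1 0 0) (h1 1 1)) (h1 2 2)) hε)
  have yy := i' (-a) (S.add_mem (S.sub_mem (S.sub_mem (h1 1 1) (h1 0 0)) (h1 2 2)) hε)
  have zz := S.add_mem (S.sub_mem (S.sub_mem (h1 2 2) (h1 0 0)) (h1 1 1)) hε
  have wx := i' b (S.add_mem (h1 1 2) (i' a (h1 2 1)))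
  have yz := S.sub_mem (h1 1 2) (i' a (h1 2 1))
  have wy := i' (-a) (S.add_mem (h1 0 2) (i' b (h1 2 0)))
  have xz := S.sub_mem (h1 0 2) (i' b (h1 2 0))
  have wz := S.sub_mem (i' a (h1 0 1)) (i' b (h1 1 0))
  have xy := S.neg_mem (S.add_mem (i' a (h1 0 1)) (i' b (h1 1 0)))
  rw [hN] at ww xx yy zz
  simp only [adM, Matrix.of_apply, Matrix.cons_val] at ww xx yy zz wx yz wy xz wz xy
  push_cast at ww xx yy zz wx yz wy xz wz xy
  rw [← hS]
  push_cast
  rw [← hL]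
  fin_cases i <;> fin_cases j <;> simp only [Fin.reduceFinMk, Fin.zero_eta, Fin.mk_one,
    Matrix.cons_val]
  · convert ww using 1; ring
  · convert wx using 1; ring
  · convert wy using 1; ring
  · convert wz using 1; ring
  · convert wx using 1; ring
  · convert xx using 1; ring
  · convert xy using 1; ring
  · convert xz using 1; ring
  · convert wy using 1; ring
  · convert xy using 1; ring
  · convert yy using 1; ring
  · convert yz using 1; ring
  · convert wz using 1; ring
  · convert xz using 1; ring
  · convert yz using 1; ring
  · convert zz using 1; ring

variable {R : Type*} [CommRing R] (f : R →+* ℂ) {d : R}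

/-- A bound for the denominators of arithmetic elements. -/
def denomBound (a b : ℤ) : ℤ := 4 * a * b * (2 * (2 * a * b) ^ 2 * (a * b)) ^ 2

theorem exists_int_quaternion (ha : 0 < (a : ℝ)) (hb : 0 < (b : ℝ))
    (hf : ∀ (x : ℝ) (w : R), (x : ℂ) = f w → ∃ m : ℤ, 2 * x = m)
    (hd : f d = Complex.I * (√(b : ℝ) : ℝ)) {g : PGL(3, ℂ)}
    (hg : g ∈ (ProjGenLinGroup.map (n := Fin 3) f).range)
    (hg' : g ∈ (projAd (a : ℝ) (b : ℝ) ha hb).range) :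
    ∃ (v : QuatPoints ℤ a b) (u : (QuatPoints ℝ a b)ˣ), (u : QuatPoints ℝ a b) = ofInt v ∧
      projAd (a : ℝ) (b : ℝ) ha hb u = g ∧ nrd v ∣ denomBound a b := by
  obtain ⟨u₀, rfl⟩ := hg'
  have hn0 := nrd_ne_zero u₀
  have hs0 : 0 < √|nrd (u₀ : QuatPoints ℝ a b)| := Real.sqrt_pos.mpr (abs_pos.mpr hn0)
  set q : QuatPoints ℝ a b := (√|nrd (u₀ : QuatPoints ℝ a b)|)⁻¹ • (u₀ : QuatPoints ℝ a b) with hqdef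
  have hq : nrd q = 1 ∨ nrd q = -1 := by
    rw [hqdef, nrd_smul, inv_pow, Real.sq_sqrt (abs_nonneg _)]
    rcases abs_choice (nrd (u₀ : QuatPoints ℝ a b)) with e | e <;> rw [e]
    · left; field_simp
    · right; field_simp
  have hqu : IsUnit q := isUnit_of_nrd_ne_zero (by rcases hq with e | e <;> rw [e] <;> norm_num)
  have hproj : projAd (a : ℝ) (b : ℝ) ha hb hqu.unit = projAd (a : ℝ) (b : ℝ) ha hb u₀ :=
    projAd_eq_of_smul ha hb (inv_ne_zero hs0.ne') rfl
  rw [← hproj] at hg ⊢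
  obtain ⟨g, hg⟩ := hg
  obtain ⟨X, rfl⟩ := ProjGenLinGroup.mk_surjective g
  rw [ProjGenLinGroup.map_mk, projAd_apply] at hg
  have hinv : ∀ k l, (((adGL hqu.unit)⁻¹).1 k l : ℝ) = adM (star q) k l := by
    intro k l
    have : (adGL hqu.unit)⁻¹.1 = adM ((hqu.unit⁻¹ : (QuatPoints ℝ a b)ˣ) : QuatPoints ℝ a b) := by
      rw [← map_inv]; rfl
    rw [this, coe_inv_eq, adM_smul]
    change ((nrd q)⁻¹ ^ 2 • adM (star q)) k l = _
    rcases hq with e | e <;> rw [e] <;> simp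
  set P := pureFrame (a : ℝ) (b : ℝ) ha hb with hP
  set A := GeneralLinearGroup.map (n := Fin 3) Complex.ofRealHom (adGL hqu.unit) with hA
  have hentry : ∀ i j k l, ∃ m : ℤ,
      ((2 * (2 * a * b) ^ 2 : ℤ) : ℝ) * (adM q i j * adM (star q) k l) = m := by
    intro i j k l
    obtain ⟨c, hc, h1⟩ := exists_smul_of_mk_eq_mk hg.symm
    have hX : X.1.map f = c • (P.1 * A.1 * (P⁻¹).1) := h1
    have hXi : (X⁻¹).1.map f = c⁻¹ • (P.1 * (A⁻¹).1 * (P⁻¹).1) := by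
      have e1 : X.1.map f * (X⁻¹).1.map f = 1 := by
        rw [← Matrix.map_mul, Units.mul_inv, Matrix.map_one _ f.map_zero f.map_one]
      have e2 : (c⁻¹ • (P.1 * (A⁻¹).1 * (P⁻¹).1)) * X.1.map f = 1 := by
        have e3 : (P * A⁻¹ * P⁻¹) * (P * A * P⁻¹) = 1 := by group
        have e4 : (P.1 * (A⁻¹).1 * (P⁻¹).1) * (P.1 * A.1 * (P⁻¹).1) = 1 := congrArg Units.val e3
        rw [hX, Matrix.smul_mul, Matrix.mul_smul, e4, smul_smul, inv_mul_cancel₀ hc, one_smul]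
      exact (left_inv_eq_right_inv e2 e1).symm
    have hPP : (P⁻¹).1 * P.1 = 1 := Units.inv_mul _
    have conjE : ∀ B : Matrix (Fin 3) (Fin 3) ℂ, pureFrameAdj (a : ℝ) (b : ℝ) *
        (P.1 * B * (P⁻¹).1) * P.1 = ((2 * a * b : ℤ) : ℂ) • B := by
      intro B
      rw [pureFrame_inv ha hb, ← hP, Matrix.smul_mul, Matrix.smul_mul]
      congr 1
      calc _ = ((P⁻¹).1 * P.1) * B * ((P⁻¹).1 * P.1) := by simp only [Matrix.mul_assoc]
        _ = B := by rw [hPP, Matrix.one_mul, Matrix.mul_one]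
    have m1 : (intFrameAdj a d * X.1 * intFrame a b d).map f =
        c • ((2 * a * b : ℤ) : ℂ) • A.1 := by
      rw [Matrix.map_mul, Matrix.map_mul, map_intFrame f hd ha hb, map_intFrameAdj f hd (b := b), hX,
        ← hP, Matrix.mul_smul, Matrix.smul_mul, conjE]
    have m2 : (intFrameAdj a d * (X⁻¹).1 * intFrame a b d).map f =
        c⁻¹ • ((2 * a * b : ℤ) : ℂ) • (A⁻¹).1 := by
      rw [Matrix.map_mul, Matrix.map_mul, map_intFrame f hd ha hb, map_intFrameAdj f hd (b := b), hXi,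
        ← hP, Matrix.mul_smul, Matrix.smul_mul, conjE]
    have hAi : (A⁻¹).1 k l = ((adM (star q) k l : ℝ) : ℂ) := by
      rw [hA, ← map_inv, ← hinv]; rfl
    have hAe : A.1 i j = ((adM q i j : ℝ) : ℂ) := rfl
    -- The unknown scalar c cancels between X and X⁻¹. Each frame contributes 2ab, and a real value
    -- of f is half of an integer, whence 2(2ab)².
    obtain ⟨m, hm⟩ := hf (((2 * a * b : ℤ) : ℝ) ^ 2 * (adM q i j * adM (star q) k l))
      ((intFrameAdj a d * X.1 * intFrame a b d) i j *
        (intFrameAdj a d * (X⁻¹).1 * intFrame a b d) k l) (by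
      have n1 := congrFun (congrFun m1 i) j
      have n2 := congrFun (congrFun m2 k) l
      rw [Matrix.map_apply] at n1 n2
      rw [map_mul, n1, n2]
      simp only [Matrix.smul_apply, smul_eq_mul, hAi, hAe]
      push_cast
      field_simp)
    refine ⟨m, ?_⟩
    rw [← hm]
    push_cast
    ring
  have ha0 : a ≠ 0 := by rintro rfl; simp at ha
  have hb0 : b ≠ 0 := by rintro rfl; simp at hb
  have hcoord := coord_mul_int hq hentry
  have hM : denomBound a b ≠ 0 := by
    have : a * b ≠ 0 := mul_ne_zero ha0 hb0
    simp [denomBound, ha0, hb0]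
  have hc0 : ![q.re, q.imI, q.imJ, q.imK] ≠ 0 := by
    intro h0
    apply hqu.ne_zero
    ext
    exacts [congrFun h0 0, congrFun h0 1, congrFun h0 2, congrFun h0 3]
  obtain ⟨v, s, e, hs, hcv, he⟩ := exists_smul_int_of_mul_int hc0 hM hcoord
  let v' : QuatPoints ℤ a b := ⟨v 0, v 1, v 2, v 3⟩
  have hqv : q = s • ofInt v' := by
    ext
    exacts [hcv 0, hcv 1, hcv 2, hcv 3]
  have hnv : nrd q = s ^ 2 * (nrd v' : ℤ) := by rw [← nrd_ofInt, ← nrd_smul, ← hqv]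
  have hvu : IsUnit (ofInt v') := by
    apply isUnit_of_nrd_ne_zero
    rw [nrd_ofInt]
    intro h0
    rw [h0, mul_zero] at hnv
    rcases hq with e | e <;> rw [e] at hnv <;> norm_num at hnv
  refine ⟨v', hvu.unit, rfl, (projAd_eq_of_smul ha hb hs hqv).symm, ?_⟩
  -- Integrality of e, the bound times s², is what makes the norm of v' divide the bound, as q has
  -- norm ±1.
  have h5 : (denomBound a b : ℝ) * nrd q = e * (nrd v' : ℤ) := by rw [hnv, ← he]; ring
  rcases hq with h6 | h6
  · rw [h6, mul_one] at h5
    exact ⟨e, by rw [mul_comm]; exact_mod_cast h5⟩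
  · refine ⟨-e, ?_⟩
    have : (denomBound a b : ℝ) = (nrd v' : ℤ) * (-e) := by rw [h6] at h5; linarith
    exact_mod_cast this

end

end Commensurability

/-! ### Finite index in both directions -/

section Conclusion

noncomputable section

open NumberField

variable {a b : ℤ} {R : Type*} [CommRing R] {f : R →+* ℂ} {d : R}

/-- The coordinates of an integral quaternion modulo `m`. -/
def residue (m : ℕ) (q : QuatPoints ℤ a b) : Fin 4 → ZMod m :=
  ![(q.re : ZMod m), (q.imI : ZMod m), (q.imJ : ZMod m), (q.imK : ZMod m)]

theorem exists_eq_add_smul {m : ℕ} {p q : QuatPoints ℤ a b} (h : residue m p = residue m q) :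
    ∃ r : QuatPoints ℤ a b, q = p + (m : ℤ) • r := by
  have h0 := (ZMod.intCast_eq_intCast_iff_dvd_sub _ _ _).mp (congrFun h 0)
  have h1 := (ZMod.intCast_eq_intCast_iff_dvd_sub _ _ _).mp (congrFun h 1)
  have h2 := (ZMod.intCast_eq_intCast_iff_dvd_sub _ _ _).mp (congrFun h 2)
  have h3 := (ZMod.intCast_eq_intCast_iff_dvd_sub _ _ _).mp (congrFun h 3)
  obtain ⟨w, hw⟩ := h0
  obtain ⟨x, hx⟩ := h1
  obtain ⟨y, hy⟩ := h2
  obtain ⟨z, hz⟩ := h3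
  refine ⟨⟨w, x, y, z⟩, ?_⟩
  ext
  · change q.re = p.re + m * w; linarith
  · change q.imI = p.imI + m * x; linarith
  · change q.imJ = p.imJ + m * y; linarith
  · change q.imK = p.imK + m * z; linarith

theorem star_mul_eq_of_residue_eq {m : ℕ} {p q : QuatPoints ℤ a b}
    (h : residue m p = residue m q) :
    ∃ r : QuatPoints ℤ a b, star p * q = ((nrd p : ℤ) : QuatPoints ℤ a b) + (m : ℤ) • r := by
  obtain ⟨r, hr⟩ := exists_eq_add_smul h
  refine ⟨star p * r, ?_⟩
  conv_lhs => rw [hr, mul_add, mul_smul_comm, star_mul_eq_nrd]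
  rfl

theorem nearScalar_one_add (m : ℤ) (r : QuatPoints ℤ a b) : NearScalar m (1 + m • r) := by
  refine ⟨⟨2 * r.re + m * r.re ^ 2, ?_⟩, ⟨r.imI, ?_⟩, ⟨r.imJ, ?_⟩, ⟨r.imK, ?_⟩⟩ <;>
    simp
  ring

theorem commensurable_of_eq_inf (ha : 0 < (a : ℝ)) (hb : 0 < (b : ℝ)) (hinj : Function.Injective f)
    (hf : ∀ (x : ℝ) (w : R), (x : ℂ) = f w → ∃ m : ℤ, 2 * x = m)
    (hd : f d = Complex.I * (√(b : ℝ) : ℝ)) {Γ : Subgroup PGL(3, ℂ)}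
    (hΓ : Γ = (ProjGenLinGroup.map (n := Fin 3) f).range ⊓ (projAd (a : ℝ) (b : ℝ) ha hb).range) :
    Subgroup.Commensurable Γ ((integralNormOne a b).map (normOneHom ha hb)) := by
  have ha0 : 0 < a := by exact_mod_cast ha
  have hb0 : 0 < b := by exact_mod_cast hb
  constructor
  · have hx : ∀ x : (integralNormOne a b).map (normOneHom ha hb), ∃ (y : NormOne a b)
        (q : QuatPoints ℤ a b), ofInt q = (y : QuatPoints ℝ a b) ∧ normOneHom ha hb y = x := by
      rintro ⟨_, y, ⟨q, hq⟩, rfl⟩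
      exact ⟨y, q, hq, rfl⟩
    choose y q hq hy using hx
    have hm : (((2 * a * b).natAbs : ℕ) : ℤ) = 2 * a * b := by
      rw [Int.natCast_natAbs, abs_of_pos (by positivity)]
    have : NeZero (2 * a * b).natAbs := ⟨by
      have : 0 < 2 * a * b := by positivity
      omega⟩
    -- For norm one quaternions with equal residues modulo 2ab, the quotient is 1 modulo 2ab and so
    -- maps into Γ.
    refine relIndex_ne_zero_of_finite (fun x => residue (2 * a * b).natAbs (q x))
      fun x x' hxx' => ?_
    have hn : ∀ x, nrd (q x) = 1 := by
      intro x
      have := mem_unitary_iff_nrd.mp (y x).2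
      rw [← hq x, nrd_ofInt] at this
      exact_mod_cast this
    obtain ⟨r, hr⟩ := star_mul_eq_of_residue_eq hxx'
    rw [hn, hm, Int.cast_one] at hr
    have hnear : NearScalar (2 * a * b) (star (q x) * q x') := by
      rw [hr]; exact nearScalar_one_add _ _
    have hnrd : nrd (star (q x) * q x') = 1 := by rw [nrd_mul, nrd_star, hn, hn, mul_one]
    have hval : (x : PGL(3, ℂ))⁻¹ * x' = projAd (a : ℝ) (b : ℝ) ha hb
        (Unitary.toUnits ((y x)⁻¹ * y x')) := by
      rw [← hy x, ← hy x', ← map_inv, ← map_mul, normOneHom_apply]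
    rw [hΓ, hval]
    refine ⟨projAd_mem_range_map f ha hb hinj hd hnear hnrd ?_, ⟨_, rfl⟩⟩
    rw [ofInt_mul, ofInt_star, hq, hq]
    rfl
  · have hx : ∀ x : Γ, ∃ (v : QuatPoints ℤ a b) (u : (QuatPoints ℝ a b)ˣ),
        (u : QuatPoints ℝ a b) = ofInt v ∧ projAd (a : ℝ) (b : ℝ) ha hb u = x ∧
          nrd v ∣ denomBound a b := by
      rintro ⟨x, hx⟩
      rw [hΓ] at hx
      exact exists_int_quaternion f ha hb hf hd hx.1 hx.2
    choose v u huv hux hdvd using hx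
    have hpos : 0 < denomBound a b := by unfold denomBound; positivity
    have hm : (((denomBound a b).natAbs : ℕ) : ℤ) = denomBound a b := by
      rw [Int.natCast_natAbs, abs_of_pos hpos]
    have : NeZero (denomBound a b).natAbs := ⟨by omega⟩
    have hbd : ∀ x, nrd (v x) ∈ Set.Icc (-denomBound a b) (denomBound a b) := by
      intro x
      have h1 : |nrd (v x)| ≤ denomBound a b :=
        Int.le_of_dvd hpos ((abs_dvd _ _).mpr (hdvd x))
      exact abs_le.mp h1
    have : Finite (Set.Icc (-denomBound a b) (denomBound a b)) := (Set.finite_Icc _ _)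
    -- Classes are separated by the norm n and the residue modulo the bound M. If both agree, star v
    -- * v' = n + M r, and n ∣ M makes this n times an integral quaternion of norm one, which
    -- represents the quotient.
    refine relIndex_ne_zero_of_finite (fun x =>
      ((⟨nrd (v x), hbd x⟩ : Set.Icc (-denomBound a b) (denomBound a b)),
        residue (denomBound a b).natAbs (v x))) fun x x' hxx' => ?_
    rw [Prod.mk.injEq, Subtype.mk.injEq] at hxx'
    obtain ⟨hnn, hres⟩ := hxx'
    obtain ⟨r, hr⟩ := star_mul_eq_of_residue_eq hres
    obtain ⟨k, hk⟩ := hdvd x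
    have hn0 : nrd (v x) ≠ 0 := by
      have := nrd_ne_zero (u x)
      rw [huv, nrd_ofInt] at this
      exact_mod_cast this
    rw [hm, hk] at hr
    have hr' : star (v x) * v x' = nrd (v x) • (1 + k • r) := by
      rw [hr, smul_add, smul_smul]
      congr 1
      ext <;> simp
    have hnrd : nrd (1 + k • r) = 1 := by
      have h1 := congrArg nrd hr'
      rw [nrd_mul, nrd_star, nrd_smul, ← hnn] at h1
      apply mul_left_cancel₀ (pow_ne_zero 2 hn0)
      rw [← h1]; ring
    have hmem : ofInt (1 + k • r) ∈ unitary (QuatPoints ℝ a b) := by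
      rw [mem_unitary_iff_nrd, nrd_ofInt, hnrd, Int.cast_one]
    refine ⟨⟨ofInt (1 + k • r), hmem⟩, ⟨1 + k • r, rfl⟩, ?_⟩
    rw [← hux x, ← hux x', ← map_inv, ← map_mul, normOneHom_apply]
    have hn0' : ((nrd (v x) : ℤ) : ℝ) ≠ 0 := by exact_mod_cast hn0
    symm
    refine projAd_eq_of_smul ha hb (c := 1) one_ne_zero ?_
    rw [one_smul, Units.val_mul, coe_inv_eq, huv, huv, nrd_ofInt, smul_mul_assoc, ← ofInt_star,
      ← ofInt_mul, hr', inv_smul_eq_iff₀ hn0']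
    change ofInt _ = _ • ofInt _
    ext <;> simp [ofInt]
    ring

end

end Conclusion

end PicardRFuchsian

theorem proposition4p4 (K : Type*) [Field K] [NumberField K] [NumberField.IsTotallyComplex K]
    (hK : Module.finrank ℚ K = 2) (ι : K →+* ℂ) (Δ : ℕ) (hΔ : 0 < Δ) :
    PicardRFuchsian.IsMaximalNonelementaryRFuchsian (PicardRFuchsian.picard ι)
        (PicardRFuchsian.stabY ι (Δ : ℂ) (Nat.cast_ne_zero.mpr hΔ.ne')) ∧
      PicardRFuchsian.ArisesFrom
        (PicardRFuchsian.stabY ι (Δ : ℂ) (Nat.cast_ne_zero.mpr hΔ.ne'))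
        (Δ : ℤ) |NumberField.discr K| := by
  open PicardRFuchsian NumberField in
  set b : ℤ := |discr K| with hbdef
  have hb1 : 1 < b := by
    have := NumberField.abs_discr_gt_two (K := K) (by rw [hK]; norm_num)
    omega
  have hb : 0 < (b : ℝ) := by exact_mod_cast (by omega : 0 < b)
  have ha : 0 < (((Δ : ℕ) : ℤ) : ℝ) := by exact_mod_cast hΔ
  have hz : (Δ : ℂ) ≠ 0 := Nat.cast_ne_zero.mpr hΔ.ne'
  let f : 𝓞 K →+* ℂ := ι.comp (algebraMap (𝓞 K) K)
  have hinj : Function.Injective f := ι.injective.comp RingOfIntegers.coe_injective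
  have hf : ∀ (x : ℝ) (w : 𝓞 K), (x : ℂ) = f w → ∃ m : ℤ, 2 * x = m := fun x w h =>
    two_mul_re_int hK ι h
  obtain ⟨d, hd⟩ : ∃ d : 𝓞 K, f d = Complex.I * (√(b : ℝ) : ℝ) := by
    obtain ⟨d, hd⟩ := exists_sq_eq_neg_abs_discr hK ι
    have h1 : (Complex.I * (√(b : ℝ) : ℝ)) ^ 2 = -(b : ℂ) := by
      have : ((√(b : ℝ) : ℝ) : ℂ) ^ 2 = b := by exact_mod_cast Real.sq_sqrt hb.le
      rw [mul_pow, Complex.I_sq, this]; ring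
    -- The square root of -|D_K| in 𝓞_K is fixed only up to sign; the sign is chosen to match
    -- `pureFrame`.
    rcases sq_eq_sq_iff_eq_or_eq_neg.mp (hd.trans h1.symm) with h | h
    · exact ⟨d, h⟩
    · exact ⟨-d, by rw [map_neg]; exact neg_eq_iff_eq_neg.mpr h⟩
  have hΓ := stabY_eq (ι := ι) ha hb (Δ : ℂ) hz (by push_cast; rfl)
  have hnear : ContainsNearScalar ha hb (stabY ι (Δ : ℂ) hz) := by
    refine ⟨2 * (Δ : ℤ) * b, by positivity, fun q u hq hn hu => ?_⟩
    rw [hΓ]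
    exact ⟨projAd_mem_range_map f ha hb hinj hd hq hn hu, ⟨_, rfl⟩⟩
  have hdisc : DiscreteTopology (stabY ι (Δ : ℂ) hz) := by
    refine discreteTopology_of_le_range f (fun x hx => ?_) (by rw [hΓ]; exact inf_le_left)
    exact one_le_norm_of_ne_zero hK ι (by rintro rfl; exact hx (map_zero f))
  have hframe : ProjGenLinGroup.mk (frame (((Δ : ℕ) : ℤ) : ℝ) ha) ∈ PU12 :=
    ⟨_, frame_mem_U12 _ ha, rfl⟩
  have hle : stabY ι (Δ : ℂ) hz ≤ conjPO12 (ProjGenLinGroup.mk (frame (((Δ : ℕ) : ℤ) : ℝ) ha)) := by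
    rw [← range_projAd ha hb, hΓ]; exact inf_le_right
  have hR : IsRFuchsian (stabY ι (Δ : ℂ) hz) := ⟨hdisc, _, hframe, hle⟩
  have hN : IsNonelementary (stabY ι (Δ : ℂ) hz) := isNonelementary_of_containsNearScalar hb1 hnear
  refine ⟨⟨⟨fun g hg => hg.1, hR, hN⟩, fun H hH hle => ?_⟩, hR, hN, ⟨splitEquiv ha hb⟩, _, hframe,
    hle, normOneHom ha hb, continuous_normOneHom ha hb, range_normOneHom ha hb,
    ker_normOneHom ha hb, commensurable_of_eq_inf ha hb hinj hf hd hΓ⟩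
  exact le_stabY_of_le hb1 _ hz hnear hH.1 hH.2.1 hle
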